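/- Let $0<\alpha<4$ and let $\mu$ be a probability distribution on $\mathbb{R}$. Write $a$ for a random variable with law $\mu$ and suppose that $\mu$ is symmetric ($a$ and $-a$ have the same law) and regularly varying with index $\alpha$: there is a slowly varying $L:(0,\infty)\to(0,\infty)$ (that is, $L$ is measurable and $\lim_{x\to\infty}L(cx)/L(x)=1$ for every $c>0$) such that $$\lim_{x\to\infty}\frac{\mathbb{P}(|a|\ge x)}{x^{-\alpha}L(x)}=1 .$$ For $n\in\mathbb{N}$ let $b_n=\inf\{x>0:\ \mathbb{P}(|a|\ge x)\le 2n^{-2}\}$, and let $A=A_n=(a_{ij})_{1\le i,j\le n}$ be a real symmetric random matrix whose entries $(a_{ij})_{1\le i\le j\le n}$ are independent with common law $\mu$. Let $\theta>0$, and for each $n\ge 1$ let $v_n\in\mathbb{S}^{n-1}\subset\mathbb{R}^n$ be a deterministic (column) vector of Euclidean norm $1$. Put $$P_n(\theta,v_n)=b_n^{-1}A+\theta\, v_nv_n^T .$$ (Here $b_n>0$ for all sufficiently large $n$.) Then the largest eigenvalue $\lambda_1(P_n(\theta,v_n))$ converges in law, as $n\to\infty$: $$\lambda_1(P_n(\theta,v_n))\Rightarrow\max(\theta,E_\alpha),$$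 where $E_\alpha>0$ is a random variable with $\mathbb{P}(E_\alpha<x)=\exp(-x^{-\alpha})$ for all $x>0$. In particular, the limit is the same for every choice of the unit vectors $v_n$. -/

import Mathlib

open MeasureTheory ProbabilityTheory Filter Topology

/-- `L : (0,∞) → (0,∞)` is slowly varying (at infinity). Only the values of `L` on `(0,∞)` matter. -/
structure IsSlowlyVarying (L : ℝ → ℝ) : Prop where
  measurable : Measurable L
  pos : ∀ x, 0 < x → 0 < L x
  tendsto : ∀ a : ℝ, 0 < a → Tendsto (fun x : ℝ => L (a * x) / L x) atTop (𝓝 1)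

/-- The law `μ` is symmetric: `a` and `-a` have the same law when `a` has law `μ`. -/
def IsSymmetricLaw (μ : Measure ℝ) : Prop :=
  μ.map (fun x => -x) = μ

/-- The tail `P(|a| ≥ x)` of a variable `a` with law `μ`. -/
noncomputable def absTail (μ : Measure ℝ) (x : ℝ) : ℝ :=
  μ.real {t : ℝ | x ≤ |t|}

/-- The law `μ` is regularly varying with index `α`:
`P(|a| ≥ x) / (x ^ (-α) * L x) → 1` as `x → ∞` for some slowly varying `L`. -/
def IsRegularlyVaryingLaw (μ : Measure ℝ) (α : ℝ) : Prop :=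
  ∃ L : ℝ → ℝ, IsSlowlyVarying L ∧
    Tendsto (fun x : ℝ => absTail μ x / (x ^ (-α) * L x)) atTop (𝓝 1)

/-- The normalization `b(y) = inf {x > 0 : P(|a| ≥ x) ≤ 2 y⁻²}`. -/
noncomputable def normalization (μ : Measure ℝ) (y : ℝ) : ℝ :=
  sInf {x : ℝ | 0 < x ∧ absTail μ x ≤ 2 * (y ^ 2)⁻¹}

/-- `A` is a real symmetric random matrix of size `n` whose entries on and above the diagonal are
independent and have common law `μ`. -/
structure IsWignerMatrix {Ω : Type*} [MeasurableSpace Ω] {n : ℕ}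
    (A : Ω → Matrix (Fin n) (Fin n) ℝ) (μ : Measure ℝ) (P : Measure Ω) : Prop where
  symm : ∀ ω, (A ω).IsSymm
  hasLaw : ∀ i j : Fin n, i ≤ j → HasLaw (fun ω => A ω i j) μ P
  indep : iIndepFun
    (fun (p : {p : Fin n × Fin n // p.1 ≤ p.2}) (ω : Ω) => A ω p.1.1 p.1.2) P

/-- The largest (real) eigenvalue of a matrix; used for symmetric matrices of size `n ≥ 1`, whose
spectrum is a nonempty finite set of reals. -/
noncomputable def largestEigenvalue {n : ℕ} (M : Matrix (Fin n) (Fin n) ℝ) : ℝ :=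
  sSup {r : ℝ | Module.End.HasEigenvalue (Matrix.toLin' M) r}

/-- The rank one perturbation `b⁻¹ A + θ v vᵀ`. -/
noncomputable def perturbedMatrix {n : ℕ} (b θ : ℝ) (v : EuclideanSpace ℝ (Fin n))
    (A : Matrix (Fin n) (Fin n) ℝ) : Matrix (Fin n) (Fin n) ℝ :=
  b⁻¹ • A + θ • Matrix.vecMulVec (fun i => v i) (fun i => v i)

/-- `E` is a positive random variable with the Fréchet distribution of shape `α` and scale `1`:
`P(E < x) = exp (-x ^ (-α))` for all `x > 0`. -/
structure IsFrechet {Ω : Type*} [MeasurableSpace Ω] (E : Ω → ℝ) (α : ℝ) (P : Measure Ω) :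
    Prop where
  aemeasurable : AEMeasurable E P
  pos : ∀ᵐ ω ∂P, 0 < E ω
  prob_lt : ∀ x : ℝ, 0 < x → P.real {ω | E ω < x} = Real.exp (-x ^ (-α))

/-!
The normalized matrix `b_n⁻¹ A` is split at a small level `δ` into `B + S`: the entries with
`|a_ij| > δ b_n` go to `B`, the others to `S`.

*The small entries are negligible.* As the law is symmetric, a closed walk contributes to
`E tr S ^ (2k)` only if it uses each edge an even number of times. A doubling argument (`truncatedMoment_le`)
shows for `α < 4` that the entries of `S` have second moment `O(n ^ (-1 - c))` with some `c > 0`,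
and fourth moment `O(n⁻²)`. Since a walk visits at most one more vertex than it uses edges
(`card_image_walk_le`), for a fixed large `k` all walks using at least two edges contribute `o(1)`
together, and the walks along a single edge contribute `O(δ ^ (2k - 4))` (`prod_moments_walk_le`,
`integral_trace_pow_le`). So the quadratic form of `S` is small with high probability once `δ` is
small.

*The large entries do not see `v_n`.* An entry is large with probability `O(n⁻²)`. With high
probability there is therefore at most one large entry in each row and none on the diagonal
(`measureReal_not_matching_le`), so that `B` is a direct sum of zeros and of blocks with rows
`(0, t)` and `(t, 0)`, with eigenvalues `±|t|`. A given row contains a large entry with probability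
`O(1 / n)`, so that the rows containing one carry little mass of the deterministic unit vector `v_n`,
whatever it is (`measureReal_mass_le`). Hence `B` and `θ v_n v_nᵀ` act on almost orthogonal
subspaces, and the largest eigenvalue of their sum is close to `max θ (max |a_ij| / b_n)`
(`isCloseToMax_of_matching`).

*The largest entry.* By regular variation `n ^ 2 P(|a| ≥ x b_n) → 2 x ^ (-α)`, and there are about
`n ^ 2 / 2` independent entries, so `max |a_ij| / b_n` is asymptotically Fréchet
(`tendsto_measureReal_forall_abs_lt`). Comparing distribution functions away from the atom `θ` of
the limit concludes the proof.
-/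

/-! ### Regularly varying tails -/

lemma absTail_nonneg (μ : Measure ℝ) (x : ℝ) : 0 ≤ absTail μ x := measureReal_nonneg

lemma absTail_le_one (μ : Measure ℝ) [IsProbabilityMeasure μ] (x : ℝ) : absTail μ x ≤ 1 :=
  measureReal_le_one

lemma absTail_antitone (μ : Measure ℝ) [IsProbabilityMeasure μ] : Antitone (absTail μ) :=
  fun _ _ hxy => measureReal_mono fun _ ht => hxy.trans ht

lemma measurableSet_le_abs (x : ℝ) : MeasurableSet {t : ℝ | x ≤ |t|} :=
  measurableSet_le measurable_const continuous_abs.measurable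

lemma absTail_pos {μ : Measure ℝ} [IsProbabilityMeasure μ] {α : ℝ}
    (h : IsRegularlyVaryingLaw μ α) (x : ℝ) : 0 < absTail μ x := by
  obtain ⟨L, hL, hlim⟩ := h
  have h1 : ∀ᶠ y in atTop, 0 < absTail μ y / (y ^ (-α) * L y) :=
    hlim.eventually (lt_mem_nhds one_pos)
  obtain ⟨y, hy1, hyx, hy0⟩ :=
    (h1.and ((eventually_ge_atTop x).and (eventually_gt_atTop 0))).exists
  have hden : 0 < y ^ (-α) * L y := mul_pos (Real.rpow_pos_of_pos hy0 _) (hL.pos y hy0)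
  have : 0 < absTail μ y := by
    rcases (absTail_nonneg μ y).eq_or_lt with h0 | h0
    · rw [← h0] at hy1; simp at hy1
    · exact h0
  exact this.trans_le (absTail_antitone μ hyx)

/-- The tail of a regularly varying law inherits the scaling limit `c ^ (-α)`. This is the only way
in which the slowly varying factor enters the argument. -/
lemma tendsto_absTail_mul_div {μ : Measure ℝ} [IsProbabilityMeasure μ] {α : ℝ}
    (h : IsRegularlyVaryingLaw μ α) {c : ℝ} (hc : 0 < c) :
    Tendsto (fun x => absTail μ (c * x) / absTail μ x) atTop (𝓝 (c ^ (-α))) := by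
  obtain ⟨L, hL, hlim⟩ := id h
  have h1 := hlim.comp (tendsto_id.const_mul_atTop hc)
  have h2 := (h1.mul ((hL.tendsto c hc).mul (hlim.inv₀ one_ne_zero))).mul_const (c ^ (-α))
  simp only [inv_one, mul_one, one_mul] at h2
  refine h2.congr' ?_
  filter_upwards [eventually_gt_atTop 0] with x hx
  have hx1 := (Real.rpow_pos_of_pos hx (-α)).ne'
  have hc1 := (Real.rpow_pos_of_pos hc (-α)).ne'
  have hLx := (hL.pos x hx).ne'
  have hLc := (hL.pos (c * x) (mul_pos hc hx)).ne'
  have hT := (absTail_pos h x).ne'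
  simp only [Function.comp, id, Real.mul_rpow hc.le hx.le]
  field_simp

lemma lt_absTail_of_lt_normalization {μ : Measure ℝ} {y x : ℝ} (hx : 0 < x)
    (hxy : x < normalization μ y) :
    2 * (y ^ 2)⁻¹ < absTail μ x := by
  by_contra! hcon
  have h : normalization μ y ≤ x := csInf_le ⟨0, fun z hz => hz.1.le⟩ ⟨hx, hcon⟩
  exact absurd h (not_le.2 hxy)

section Normalization

variable {μ : Measure ℝ} [IsProbabilityMeasure μ] {α : ℝ}

lemma tendsto_absTail_atTop (μ : Measure ℝ) [IsProbabilityMeasure μ] :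
    Tendsto (absTail μ) atTop (𝓝 0) := by
  have h := tendsto_measure_iInter_atTop (μ := μ) (s := fun n : ℕ => {t : ℝ | (n : ℝ) ≤ |t|})
    (fun n => (measurableSet_le_abs _).nullMeasurableSet)
    (fun m n hmn t (ht : (n : ℝ) ≤ |t|) => (Nat.cast_le.2 hmn).trans ht) ⟨0, measure_ne_top _ _⟩
  have he : ⋂ n : ℕ, {t : ℝ | (n : ℝ) ≤ |t|} = ∅ := by
    ext t
    simp only [Set.mem_iInter, Set.mem_ofPred_eq, Set.mem_empty_iff_false, iff_false, not_forall,
      not_le]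
    exact exists_nat_gt _
  rw [he, measure_empty] at h
  have h' : Tendsto (fun n : ℕ => absTail μ n) atTop (𝓝 0) := by
    have := (ENNReal.tendsto_toReal ENNReal.zero_ne_top).comp h
    simpa [absTail, Measure.real, Function.comp_def] using this
  rw [Metric.tendsto_atTop] at h' ⊢
  intro ε hε
  obtain ⟨N, hN⟩ := h' ε hε
  refine ⟨N, fun x hx => ?_⟩
  have := hN N le_rfl
  rw [Real.dist_eq, sub_zero, abs_of_nonneg (absTail_nonneg _ _)] at this ⊢
  exact (absTail_antitone μ hx).trans_lt this

lemma absTail_le_of_normalization_lt {y x : ℝ} (hy : 0 < y) (hxy : normalization μ y < x) :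
    absTail μ x ≤ 2 * (y ^ 2)⁻¹ := by
  have hne : {x : ℝ | 0 < x ∧ absTail μ x ≤ 2 * (y ^ 2)⁻¹}.Nonempty := by
    have h1 := (tendsto_absTail_atTop μ).eventually
      (gt_mem_nhds (show (0 : ℝ) < 2 * (y ^ 2)⁻¹ by positivity))
    obtain ⟨z, hz, hz0⟩ := (h1.and (eventually_gt_atTop 0)).exists
    exact ⟨z, hz0, hz.le⟩
  obtain ⟨z, hz, hzx⟩ := exists_lt_of_csInf_lt hne hxy
  exact (absTail_antitone μ hzx.le).trans hz.2

lemma tendsto_normalization_atTop (h : IsRegularlyVaryingLaw μ α) :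
    Tendsto (fun n : ℕ => normalization μ n) atTop atTop := by
  rw [tendsto_atTop]
  intro K
  have h1 : Tendsto (fun n : ℕ => 2 * ((n : ℝ) ^ 2)⁻¹) atTop (𝓝 (2 * 0)) :=
    ((tendsto_inv_atTop_zero.comp (tendsto_pow_atTop two_ne_zero)).comp
      tendsto_natCast_atTop_atTop).const_mul 2
  rw [mul_zero] at h1
  filter_upwards [h1.eventually (gt_mem_nhds (absTail_pos h K)), eventually_gt_atTop 0]
    with n hn hn0
  by_contra! hK
  exact absurd (absTail_le_of_normalization_lt (Nat.cast_pos.2 hn0) hK) (not_le.2 hn)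

/-- The normalization is chosen so that a fixed entry exceeds `x b_n` with probability asymptotic to
`2 n⁻² x ^ (-α)`. -/
lemma tendsto_sq_mul_absTail (h : IsRegularlyVaryingLaw μ α) {x : ℝ} (hx : 0 < x) :
    Tendsto (fun n : ℕ => (n : ℝ) ^ 2 * absTail μ (x * normalization μ n)) atTop
      (𝓝 (2 * x ^ (-α))) := by
  have hb := tendsto_normalization_atTop h
  have key : Tendsto (fun n : ℕ => (n : ℝ) ^ 2 * absTail μ (normalization μ n)) atTop (𝓝 2) := by
    have hcont : Tendsto (fun c : ℝ => 2 / c ^ (-α)) (𝓝 1) (𝓝 2) := by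
      have : ContinuousAt (fun c : ℝ => 2 / c ^ (-α)) 1 :=
        continuousAt_const.div (Real.continuousAt_rpow_const _ _ (Or.inl one_ne_zero)) (by simp)
      simpa [ContinuousAt] using this
    rw [tendsto_order]
    constructor
    · intro r hr
      have h1 : ∀ᶠ c : ℝ in 𝓝[<] 1, r < 2 / c ^ (-α) :=
        (hcont.mono_left nhdsWithin_le_nhds).eventually (lt_mem_nhds hr)
      have h2 : ∀ᶠ c : ℝ in 𝓝[<] 1, 0 < c := nhdsWithin_le_nhds (lt_mem_nhds one_pos)
      obtain ⟨c, ⟨hc1, hc0⟩, hc2⟩ := ((h1.and h2).and self_mem_nhdsWithin).exists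
      have hlim := ((tendsto_absTail_mul_div h hc0).comp hb)
      have hlim2 := (hlim.inv₀ (Real.rpow_pos_of_pos hc0 _).ne').const_mul 2
      filter_upwards [hlim2.eventually (lt_mem_nhds (by simpa [div_eq_mul_inv] using hc1)),
        hb.eventually (eventually_gt_atTop 0), eventually_gt_atTop 0] with n hn hbn hn0
      refine hn.trans_le ?_
      have hn0' : (0 : ℝ) < n := Nat.cast_pos.2 hn0
      have h3 : 2 * ((n : ℝ) ^ 2)⁻¹ < absTail μ (c * normalization μ n) :=
        lt_absTail_of_lt_normalization (mul_pos hc0 hbn)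
          (by have : c < 1 := hc2
              nlinarith)
      have hTb := absTail_pos h (normalization μ n)
      have hTc := absTail_pos h (c * normalization μ n)
      simp only [Function.comp, inv_div]
      rw [← div_eq_mul_inv, div_lt_iff₀ (by positivity)] at h3
      rw [← mul_div_assoc, div_le_iff₀ hTc]
      nlinarith
    · intro r hr
      have h1 : ∀ᶠ c : ℝ in 𝓝[>] 1, 2 / c ^ (-α) < r :=
        (hcont.mono_left nhdsWithin_le_nhds).eventually (gt_mem_nhds hr)
      obtain ⟨c, hc1, hc2⟩ := (h1.and self_mem_nhdsWithin).exists
      have hc2 : 1 < c := hc2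
      have hc0 : 0 < c := one_pos.trans hc2
      have hlim := ((tendsto_absTail_mul_div h hc0).comp hb)
      have hlim2 := (hlim.inv₀ (Real.rpow_pos_of_pos hc0 _).ne').const_mul 2
      filter_upwards [hlim2.eventually (gt_mem_nhds (by simpa [div_eq_mul_inv] using hc1)),
        hb.eventually (eventually_gt_atTop 0), eventually_gt_atTop 0] with n hn hbn hn0
      refine lt_of_le_of_lt ?_ hn
      have hn0' : (0 : ℝ) < n := Nat.cast_pos.2 hn0
      have h3 : absTail μ (c * normalization μ n) ≤ 2 * ((n : ℝ) ^ 2)⁻¹ :=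
        absTail_le_of_normalization_lt hn0' (by nlinarith)
      have hTb := absTail_pos h (normalization μ n)
      have hTc := absTail_pos h (c * normalization μ n)
      simp only [Function.comp, inv_div]
      rw [← div_eq_mul_inv, le_div_iff₀ (by positivity)] at h3
      rw [← mul_div_assoc, le_div_iff₀ hTc]
      nlinarith
  refine (key.mul ((tendsto_absTail_mul_div h hx).comp hb)).congr fun n => ?_
  have := (absTail_pos h (normalization μ n)).ne'
  simp only [Function.comp]
  field_simp

end Normalization

/-! ### Truncated moments -/

lemma integrable_abs_pow_indicator (μ : Measure ℝ) [IsProbabilityMeasure μ] (p : ℕ) (x : ℝ) :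
    Integrable ({t : ℝ | |t| ≤ x}.indicator fun t => |t| ^ p) μ := by
  refine Integrable.of_bound
    ((by fun_prop : Measurable fun t : ℝ => |t| ^ p).indicator
      (measurableSet_le continuous_abs.measurable measurable_const)).aestronglyMeasurable
    (|x| ^ p) (ae_of_all _ fun t => ?_)
  by_cases ht : t ∈ {t : ℝ | |t| ≤ x}
  · rw [Set.indicator_of_mem ht, Real.norm_eq_abs, abs_pow, abs_abs]
    exact pow_le_pow_left₀ (abs_nonneg _) (le_trans ht (le_abs_self x)) p
  · rw [Set.indicator_of_notMem ht, norm_zero]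
    positivity

/-- The truncated absolute moment `E[|a| ^ p; |a| ≤ x]` of a law. -/
noncomputable def truncatedMoment (μ : Measure ℝ) (p : ℕ) (x : ℝ) : ℝ :=
  ∫ t, {t : ℝ | |t| ≤ x}.indicator (fun t => |t| ^ p) t ∂μ

lemma truncatedMoment_le_pow (μ : Measure ℝ) [IsProbabilityMeasure μ] (p : ℕ) {x : ℝ}
    (hx : 0 ≤ x) : truncatedMoment μ p x ≤ x ^ p := by
  have h : truncatedMoment μ p x ≤ ∫ _, x ^ p ∂μ := by
    refine integral_mono (integrable_abs_pow_indicator μ p x) (integrable_const _) fun t => ?_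
    by_cases ht : t ∈ {t : ℝ | |t| ≤ x}
    · simp only [Set.indicator_of_mem ht]
      exact pow_le_pow_left₀ (abs_nonneg _) ht p
    · simp only [Set.indicator_of_notMem ht]
      positivity
  simpa using h

lemma truncatedMoment_two_mul_le (μ : Measure ℝ) [IsProbabilityMeasure μ] (p : ℕ) {x : ℝ}
    (hx : 0 ≤ x) :
    truncatedMoment μ p (2 * x) ≤ truncatedMoment μ p x + (2 * x) ^ p * absTail μ x := by
  have hi : Integrable ({t : ℝ | x ≤ |t|}.indicator fun _ => (2 * x) ^ p) μ :=
    (integrable_const _).indicator (measurableSet_le_abs x)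
  have h : truncatedMoment μ p (2 * x) ≤ ∫ t, ({t : ℝ | |t| ≤ x}.indicator (fun t => |t| ^ p) t +
      {t : ℝ | x ≤ |t|}.indicator (fun _ => (2 * x) ^ p) t) ∂μ := by
    refine integral_mono (integrable_abs_pow_indicator μ p _)
      ((integrable_abs_pow_indicator μ p x).add hi) fun t => ?_
    simp only [Set.indicator_apply, Set.mem_ofPred_eq]
    have h0 : (0 : ℝ) ≤ (2 * x) ^ p := by positivity
    have h1 : 0 ≤ |t| ^ p := by positivity
    split_ifs with h2 h3 h4 h3 h4 <;> try linarith
    exact (pow_le_pow_left₀ (abs_nonneg _) h2 p).trans (by simp)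
  rw [integral_add (integrable_abs_pow_indicator μ p x) hi,
    integral_indicator (measurableSet_le_abs x)] at h
  simpa [truncatedMoment, absTail, mul_comm] using h

/-- A Karamata-type bound: if the tail loses at most the factor `D` when the argument doubles and
`D ^ γ < 2 ^ p`, then `E[|a| ^ p; |a| ≤ x] = O(x ^ p P(|a| ≥ x) ^ γ)`. Under doubling of `x`, the
quotient of the two sides is mapped to at most an affine function of itself with slope
`D ^ γ / 2 ^ p < 1`, so it stays bounded. -/
lemma truncatedMoment_le {μ : Measure ℝ} [IsProbabilityMeasure μ]
    (hpos : ∀ x, 0 < absTail μ x) (p : ℕ) {γ D x₀ : ℝ} (hγ0 : 0 ≤ γ) (hγ1 : γ ≤ 1) (hD : 0 < D)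
    (hx₀ : 0 < x₀) (hdouble : ∀ x, x₀ ≤ x → absTail μ x ≤ D * absTail μ (2 * x))
    (hDp : D ^ γ < 2 ^ p) :
    ∃ C, 0 < C ∧ ∀ x, x₀ ≤ x → truncatedMoment μ p x ≤ C * (x ^ p * absTail μ x ^ γ) := by
  set q : ℝ := D ^ γ / 2 ^ p with hq
  have hDγ : 0 < D ^ γ := Real.rpow_pos_of_pos hD _
  have hq0 : 0 < q := by positivity
  have hq1 : q < 1 := (div_lt_one (by positivity)).2 hDp
  set C : ℝ := max (1 / absTail μ (2 * x₀) ^ γ) (2 ^ p * q / (1 - q)) with hC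
  have hT0 : ∀ x, 0 < absTail μ x ^ γ := fun x => Real.rpow_pos_of_pos (hpos x) _
  have hC0 : 0 < C := lt_max_of_lt_left (one_div_pos.2 (hT0 _))
  have hCq : (C + 2 ^ p) * q ≤ C := by
    have : 2 ^ p * q / (1 - q) ≤ C := le_max_right _ _
    rw [div_le_iff₀ (by linarith)] at this
    linarith
  refine ⟨C, hC0, ?_⟩
  have main : ∀ k : ℕ, ∀ x, x₀ ≤ x → x ≤ 2 ^ (k + 1) * x₀ →
      truncatedMoment μ p x ≤ C * (x ^ p * absTail μ x ^ γ) := by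
    intro k
    induction k with
    | zero =>
      intro x hx1 hx2
      have hx0 : 0 ≤ x := hx₀.le.trans hx1
      refine (truncatedMoment_le_pow μ p hx0).trans ?_
      have h1 : absTail μ (2 * x₀) ^ γ ≤ absTail μ x ^ γ :=
        Real.rpow_le_rpow (absTail_nonneg _ _) (absTail_antitone μ (by simpa using hx2)) hγ0
      have h2 : 1 ≤ C * absTail μ x ^ γ := by
        have : 1 / absTail μ (2 * x₀) ^ γ ≤ C := le_max_left _ _
        rw [div_le_iff₀ (hT0 _)] at this
        exact this.trans (mul_le_mul_of_nonneg_left h1 hC0.le)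
      have h3 : 0 ≤ x ^ p := by positivity
      nlinarith
    | succ k ih =>
      intro x hx1 hx2
      rcases le_total x (2 ^ (k + 1) * x₀) with hle | hge
      · exact ih x hx1 hle
      · obtain ⟨y, rfl⟩ : ∃ y, x = 2 * y := ⟨x / 2, by ring⟩
        have hy1 : x₀ ≤ y := by
          have h1 : (1 : ℝ) ≤ 2 ^ k := one_le_pow₀ one_le_two
          rw [pow_succ] at hge
          nlinarith
        have hy2 : y ≤ 2 ^ (k + 1) * x₀ := by
          rw [pow_succ] at hx2
          linarith
        have hy0 : 0 ≤ y := hx₀.le.trans hy1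
        have hyp : 0 ≤ y ^ p := by positivity
        have hTy : absTail μ y ≤ absTail μ y ^ γ := by
          have := Real.rpow_le_rpow_of_exponent_ge (hpos y) (absTail_le_one μ y) hγ1
          rwa [Real.rpow_one] at this
        have hTy2 : absTail μ y ^ γ ≤ D ^ γ * absTail μ (2 * y) ^ γ := by
          rw [← Real.mul_rpow hD.le (absTail_nonneg _ _)]
          exact Real.rpow_le_rpow (absTail_nonneg _ _) (hdouble y hy1) hγ0
        calc truncatedMoment μ p (2 * y)
            ≤ truncatedMoment μ p y + (2 * y) ^ p * absTail μ y :=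
              truncatedMoment_two_mul_le μ p hy0
          _ ≤ C * (y ^ p * absTail μ y ^ γ) + (2 * y) ^ p * absTail μ y ^ γ := by
              gcongr
              exact ih y hy1 hy2
          _ = (C + 2 ^ p) * y ^ p * absTail μ y ^ γ := by rw [mul_pow]; ring
          _ ≤ (C + 2 ^ p) * y ^ p * (D ^ γ * absTail μ (2 * y) ^ γ) := by gcongr
          _ = ((C + 2 ^ p) * q) * ((2 * y) ^ p * absTail μ (2 * y) ^ γ) := by
              rw [hq, mul_pow]; field_simp
          _ ≤ C * ((2 * y) ^ p * absTail μ (2 * y) ^ γ) := by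
              have := hT0 (2 * y)
              gcongr
  intro x hx
  obtain ⟨k, hk⟩ := pow_unbounded_of_one_lt (x / x₀) one_lt_two
  refine main k x hx ?_
  rw [div_lt_iff₀ hx₀] at hk
  refine hk.le.trans ?_
  gcongr
  · norm_num
  · omega

/-- The second and fourth moments of the truncated, normalized entries. For `α < 4` the truncated
second moment is smaller than `1 / n` by a power of `n`, and the truncated fourth moment is
`O(n⁻²)`. -/
lemma exists_truncatedMoment_bounds {μ : Measure ℝ} [IsProbabilityMeasure μ] {α : ℝ}
    (hα4 : α < 4) (h : IsRegularlyVaryingLaw μ α) :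
    ∃ c C : ℝ, 0 < c ∧ c ≤ 1 ∧ 1 ≤ C ∧ ∀ᶠ n : ℕ in atTop,
      truncatedMoment μ 2 (normalization μ n) ≤
        C * ((normalization μ n) ^ 2 * ((n : ℝ)⁻¹ * (n : ℝ) ^ (-c))) ∧
      truncatedMoment μ 4 (normalization μ n) ≤
        C * ((normalization μ n) ^ 4 * ((n : ℝ)⁻¹) ^ 2) := by
  have hb := tendsto_normalization_atTop h
  -- `2 ^ β` is an admissible doubling constant for some `β < 4`; the exponent `γ` lies strictly
  -- between `1 / 2` and `2 / β`.
  obtain ⟨β, hβα, hβ2, hβ4⟩ : ∃ β, α < β ∧ 2 ≤ β ∧ β < 4 := by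
    refine ⟨max (α / 2 + 2) 2, ?_, le_max_right _ _, max_lt ?_ ?_⟩
    · exact lt_max_of_lt_left (by linarith)
    · linarith
    · norm_num
  have hβ0 : 0 < β := by linarith
  set γ : ℝ := 1 / 4 + 1 / β with hγ
  have hγ1 : 1 / 2 < γ := by
    have : 1 / 4 < 1 / β := one_div_lt_one_div_of_lt hβ0 hβ4
    linarith
  have hγ2 : γ ≤ 1 := by
    have : 1 / β ≤ 1 / 2 := one_div_le_one_div_of_le two_pos hβ2
    linarith
  have hγβ : β * γ < 2 := by
    rw [hγ, mul_add, mul_one_div_cancel hβ0.ne']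
    linarith
  have hdoub : ∀ᶠ x in atTop, absTail μ x ≤ 2 ^ β * absTail μ (2 * x) := by
    have h1 : (2 : ℝ) ^ (-β) < 2 ^ (-α) :=
      Real.rpow_lt_rpow_of_exponent_lt one_lt_two (by linarith)
    filter_upwards [(tendsto_absTail_mul_div h two_pos).eventually (lt_mem_nhds h1)] with x hx
    rw [lt_div_iff₀ (absTail_pos h x), Real.rpow_neg two_pos.le,
      inv_mul_lt_iff₀ (Real.rpow_pos_of_pos two_pos β)] at hx
    exact hx.le
  obtain ⟨x₀, hx₀⟩ := eventually_atTop.1 hdoub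
  have hx₁ : (0 : ℝ) < max x₀ 1 := lt_max_of_lt_right one_pos
  have hD : (0 : ℝ) < 2 ^ β := Real.rpow_pos_of_pos two_pos β
  have hd : ∀ x, max x₀ 1 ≤ x → absTail μ x ≤ 2 ^ β * absTail μ (2 * x) :=
    fun x hx => hx₀ x ((le_max_left _ _).trans hx)
  obtain ⟨C₂, hC₂, hm₂⟩ := truncatedMoment_le (absTail_pos h) 2 (γ := γ) (by linarith) hγ2 hD hx₁ hd
    (by
      rw [← Real.rpow_mul two_pos.le, ← Real.rpow_natCast]
      exact Real.rpow_lt_rpow_of_exponent_lt one_lt_two (by simpa using hγβ))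
  obtain ⟨C₄, hC₄, hm₄⟩ := truncatedMoment_le (absTail_pos h) 4 (γ := 1) (by norm_num) le_rfl hD
    hx₁ hd
    (by
      rw [Real.rpow_one, ← Real.rpow_natCast]
      exact Real.rpow_lt_rpow_of_exponent_lt one_lt_two (by simpa using hβ4))
  refine ⟨2 * γ - 1, max 1 (3 * max C₂ C₄), by linarith, by linarith, le_max_left _ _, ?_⟩
  have hT := tendsto_sq_mul_absTail h one_pos
  simp only [Real.one_rpow, mul_one, one_mul] at hT
  filter_upwards [hb.eventually (eventually_ge_atTop (max x₀ 1)),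
    hT.eventually (gt_mem_nhds (show (2 : ℝ) < 3 by norm_num)), eventually_gt_atTop 0]
    with n hn hn3 hn0
  have hn0' : (0 : ℝ) < n := Nat.cast_pos.2 hn0
  have hT3 : absTail μ (normalization μ n) ≤ 3 * ((n : ℝ)⁻¹) ^ 2 := by
    rw [inv_pow, ← div_eq_mul_inv, le_div_iff₀ (by positivity)]
    linarith
  have hb0 : 0 < normalization μ n := hx₁.trans_le hn
  have hmul : ∀ {X Y : ℝ}, C₂ ≤ max C₂ C₄ → 0 ≤ Y → X ≤ 3 * Y → 0 ≤ X →
      max C₂ C₄ * X ≤ max 1 (3 * max C₂ C₄) * Y := by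
    intro X Y hC hY hXY hX
    calc max C₂ C₄ * X ≤ max C₂ C₄ * (3 * Y) := by
          have := hC₂.trans_le hC
          gcongr
      _ = (3 * max C₂ C₄) * Y := by ring
      _ ≤ _ := by gcongr; exact le_max_right _ _
  have hTn := absTail_nonneg μ (normalization μ n)
  constructor
  · have hTγ : absTail μ (normalization μ n) ^ γ ≤ 3 * ((n : ℝ)⁻¹ * (n : ℝ) ^ (-(2 * γ - 1))) := by
      calc absTail μ (normalization μ n) ^ γ ≤ (3 * ((n : ℝ)⁻¹) ^ 2) ^ γ :=
            Real.rpow_le_rpow hTn hT3 (by linarith)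
        _ = 3 ^ γ * ((n : ℝ)⁻¹ * (n : ℝ) ^ (-(2 * γ - 1))) := by
            rw [Real.mul_rpow (by norm_num) (by positivity), ← Real.rpow_natCast,
              ← Real.rpow_mul (by positivity), Real.inv_rpow hn0'.le, ← Real.rpow_neg hn0'.le,
              ← Real.rpow_neg_one (n : ℝ), ← Real.rpow_add hn0']
            congr 2
            push_cast
            ring
        _ ≤ 3 ^ (1 : ℝ) * ((n : ℝ)⁻¹ * (n : ℝ) ^ (-(2 * γ - 1))) := by
            gcongr
            norm_num
        _ = _ := by rw [Real.rpow_one]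
    refine (hm₂ _ hn).trans (le_trans (mul_le_mul_of_nonneg_right (le_max_left C₂ C₄)
      (by positivity)) (hmul (le_max_left _ _) (by positivity) ?_ (by positivity)))
    rw [mul_left_comm]
    gcongr
  · refine (hm₄ _ hn).trans (le_trans (mul_le_mul_of_nonneg_right (le_max_right C₂ C₄)
      (by positivity)) (hmul (le_max_left _ _) (by positivity) ?_ (by positivity)))
    rw [mul_left_comm, Real.rpow_one]
    gcongr

/-! ### The largest eigenvalue and quadratic forms -/

section Deterministic

open Matrix

variable {n : ℕ}

/-- The largest eigenvalue of a symmetric matrix of positive size is attained, so that the supremum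
in its definition is not a junk value, and it bounds the Rayleigh quotient. -/
lemma isGreatest_largestEigenvalue {M : Matrix (Fin n) (Fin n) ℝ} (hn : 0 < n) (hM : M.IsSymm) :
    IsGreatest {r : ℝ | Module.End.HasEigenvalue (Matrix.toLin' M) r} (largestEigenvalue M) ∧
      ∀ x : Fin n → ℝ, x ⬝ᵥ M *ᵥ x ≤ largestEigenvalue M * (x ⬝ᵥ x) := by
  have : Nonempty (Fin n) := ⟨⟨0, hn⟩⟩
  have hT : (Matrix.toEuclideanLin M).IsSymmetric :=
    Matrix.isSymmetric_toEuclideanLin_iff.2 (by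
      rw [Matrix.IsHermitian, conjTranspose_eq_transpose_of_trivial]
      exact hM)
  have hR := hT.hasEigenvalue_iSup_of_finiteDimensional
  set R : ℝ := ⨆ x : { x : EuclideanSpace ℝ (Fin n) // x ≠ 0 },
    RCLike.re (inner ℝ (Matrix.toEuclideanLin M x) (x : EuclideanSpace ℝ (Fin n))) /
      ‖(x : EuclideanSpace ℝ (Fin n))‖ ^ 2 with hRdef
  have hbdd : BddAbove (Set.range fun x : { x : EuclideanSpace ℝ (Fin n) // x ≠ 0 } =>
    RCLike.re (inner ℝ (Matrix.toEuclideanLin M x) (x : EuclideanSpace ℝ (Fin n))) /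
      ‖(x : EuclideanSpace ℝ (Fin n))‖ ^ 2) := by
    refine ⟨‖(Matrix.toEuclideanLin M).toContinuousLinearMap‖, ?_⟩
    rintro _ ⟨x, rfl⟩
    exact (le_abs_self _).trans
      ((Matrix.toEuclideanLin M).toContinuousLinearMap.rayleighQuotient_le_norm x)
  have hquad : ∀ x : Fin n → ℝ, x ⬝ᵥ M *ᵥ x ≤ R * (x ⬝ᵥ x) := by
    intro x
    rcases eq_or_ne x 0 with rfl | hx
    · simp
    have hx' : WithLp.toLp 2 x ≠ 0 := by simpa using hx
    have h1 := le_ciSup hbdd ⟨WithLp.toLp 2 x, hx'⟩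
    rw [div_le_iff₀ (by positivity)] at h1
    have h2 : ‖WithLp.toLp 2 x‖ ^ 2 = x ⬝ᵥ x := by
      rw [EuclideanSpace.norm_sq_eq]
      simp [dotProduct, sq]
    have h3 : inner ℝ (Matrix.toEuclideanLin M (WithLp.toLp 2 x)) (WithLp.toLp 2 x) =
        x ⬝ᵥ M *ᵥ x := by
      simp [Matrix.toLpLin_toLp, EuclideanSpace.inner_toLp_toLp]
    rw [h2] at h1
    exact h3 ▸ h1
  have heig : Module.End.HasEigenvalue (Matrix.toLin' M) R := by
    obtain ⟨u, hu⟩ := hR.exists_hasEigenvector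
    refine Module.End.hasEigenvalue_of_hasEigenvector (x := WithLp.ofLp u) ⟨?_, ?_⟩
    · rw [Module.End.mem_eigenspace_iff]
      have := congrArg WithLp.ofLp hu.apply_eq_smul
      simpa using this
    · simpa using hu.2
  have hgreat : IsGreatest {r : ℝ | Module.End.HasEigenvalue (Matrix.toLin' M) r} R := by
    refine ⟨heig, fun r hr => ?_⟩
    obtain ⟨u, hu⟩ := Module.End.HasEigenvalue.exists_hasEigenvector hr
    have h1 := hquad u
    have h2 : M *ᵥ u = r • u := by simpa using hu.apply_eq_smul
    rw [h2, dotProduct_smul, smul_eq_mul] at h1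
    have h3 : 0 < u ⬝ᵥ u := by
      have := (dotProduct_self_star_pos_iff (v := u)).2 hu.2
      simpa using this
    exact le_of_mul_le_mul_right h1 h3
  have heq : largestEigenvalue M = R := hgreat.csSup_eq
  rw [heq]
  exact ⟨hgreat, hquad⟩

lemma dotProduct_mulVec_le_largestEigenvalue {M : Matrix (Fin n) (Fin n) ℝ} (hn : 0 < n)
    (hM : M.IsSymm) (x : Fin n → ℝ) : x ⬝ᵥ M *ᵥ x ≤ largestEigenvalue M * (x ⬝ᵥ x) :=
  (isGreatest_largestEigenvalue hn hM).2 x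

lemma largestEigenvalue_le {M : Matrix (Fin n) (Fin n) ℝ} (hn : 0 < n) (hM : M.IsSymm) {c : ℝ}
    (h : ∀ x : Fin n → ℝ, x ⬝ᵥ M *ᵥ x ≤ c * (x ⬝ᵥ x)) : largestEigenvalue M ≤ c := by
  obtain ⟨u, hu⟩ :=
    Module.End.HasEigenvalue.exists_hasEigenvector (isGreatest_largestEigenvalue hn hM).1.1
  have h1 := h u
  have h2 : M *ᵥ u = largestEigenvalue M • u := by simpa using hu.apply_eq_smul
  rw [h2, dotProduct_smul, smul_eq_mul] at h1
  have h3 : 0 < u ⬝ᵥ u := by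
    have := (dotProduct_self_star_pos_iff (v := u)).2 hu.2
    simpa using this
  exact le_of_mul_le_mul_right h1 h3

lemma largestEigenvalue_add_le {M S : Matrix (Fin n) (Fin n) ℝ} (hn : 0 < n) (hM : M.IsSymm)
    (hS : S.IsSymm) {ρ : ℝ} (h : ∀ x : Fin n → ℝ, x ⬝ᵥ S *ᵥ x ≤ ρ * (x ⬝ᵥ x)) :
    largestEigenvalue (M + S) ≤ largestEigenvalue M + ρ := by
  refine largestEigenvalue_le hn (hM.add hS) fun x => ?_
  rw [add_mulVec, dotProduct_add, add_mul]
  exact add_le_add (dotProduct_mulVec_le_largestEigenvalue hn hM x) (h x)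

/-- A bound on the trace of an even power bounds the quadratic form of a symmetric matrix. -/
lemma abs_dotProduct_mulVec_le_of_trace {S : Matrix (Fin n) (Fin n) ℝ} (hn : 0 < n)
    (hS : S.IsSymm) {k : ℕ} (hk : k ≠ 0) {ρ : ℝ} (hρ : 0 ≤ ρ)
    (h : (S ^ (2 * k)).trace ≤ ρ ^ (2 * k)) (x : Fin n → ℝ) :
    |x ⬝ᵥ S *ᵥ x| ≤ ρ * (x ⬝ᵥ x) := by
  have key : ∀ S : Matrix (Fin n) (Fin n) ℝ, S.IsSymm → (S ^ (2 * k)).trace ≤ ρ ^ (2 * k) →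
      ∀ x : Fin n → ℝ, x ⬝ᵥ S *ᵥ x ≤ ρ * (x ⬝ᵥ x) := by
    intro S hS h x
    have hx : 0 ≤ x ⬝ᵥ x := by simpa using dotProduct_self_star_nonneg x
    refine (dotProduct_mulVec_le_largestEigenvalue hn hS x).trans
      (mul_le_mul_of_nonneg_right ?_ hx)
    obtain ⟨u, hu⟩ :=
      Module.End.HasEigenvalue.exists_hasEigenvector (isGreatest_largestEigenvalue hn hS).1.1
    set l := largestEigenvalue S
    have hu1 : S *ᵥ u = l • u := by simpa using hu.apply_eq_smul
    have hu0 : 0 < u ⬝ᵥ u := by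
      have := (dotProduct_self_star_pos_iff (v := u)).2 hu.2
      simpa using this
    have hpow : ∀ m : ℕ, (S ^ m) *ᵥ u = l ^ m • u := by
      intro m
      induction m with
      | zero => simp
      | succ m ih => rw [pow_succ, ← mulVec_mulVec, hu1, mulVec_smul, ih, smul_smul, pow_succ,
          mul_comm]
    -- `λ ^ 2k |u|² = |S ^ k u|²` is at most the squared Hilbert–Schmidt norm of `S ^ k` times
    -- `|u|²`, by Cauchy–Schwarz in each row.
    have h1 : l ^ (2 * k) * (u ⬝ᵥ u) ≤ (S ^ (2 * k)).trace * (u ⬝ᵥ u) := by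
      have e1 : l ^ (2 * k) * (u ⬝ᵥ u) = ∑ i, (((S ^ k) *ᵥ u) i) ^ 2 := by
        rw [hpow, dotProduct, Finset.mul_sum]
        refine Finset.sum_congr rfl fun i _ => ?_
        simp only [Pi.smul_apply, smul_eq_mul]
        ring
      have e2 : (S ^ (2 * k)).trace = ∑ i, ∑ j, ((S ^ k) i j) ^ 2 := by
        rw [two_mul, pow_add, trace]
        refine Finset.sum_congr rfl fun i _ => ?_
        rw [diag_apply, mul_apply]
        refine Finset.sum_congr rfl fun j _ => ?_
        rw [sq, (hS.pow k).apply i j]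
      rw [e1, e2, Finset.sum_mul]
      refine Finset.sum_le_sum fun i _ => ?_
      have := Finset.sum_mul_sq_le_sq_mul_sq Finset.univ (fun j => (S ^ k) i j) u
      simpa [mulVec, dotProduct, sq] using this
    have h2 : l ^ (2 * k) ≤ ρ ^ (2 * k) := (le_of_mul_le_mul_right h1 hu0).trans h
    by_contra! hlt
    exact absurd h2 (not_le.2 (pow_lt_pow_left₀ hlt hρ (by omega)))
  rw [abs_le']
  refine ⟨key S hS h x, ?_⟩
  have := key (-S) hS.neg (by rwa [(even_two_mul k).neg_pow]) x
  simpa [neg_mulVec] using this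

/-! ### Measurability of the largest eigenvalue -/

lemma dotProduct_mulVec_le_sum_abs (S : Matrix (Fin n) (Fin n) ℝ) (x : Fin n → ℝ) :
    x ⬝ᵥ S *ᵥ x ≤ (∑ i, ∑ j, |S i j|) * (x ⬝ᵥ x) := by
  have hx : ∀ i, x i * x i ≤ ∑ l, x l * x l := fun i =>
    Finset.single_le_sum (fun l _ => mul_self_nonneg (x l)) (Finset.mem_univ i)
  rw [Finset.sum_mul]
  refine Finset.sum_le_sum fun i _ => ?_
  rw [mulVec, dotProduct, Finset.mul_sum, Finset.sum_mul]
  refine Finset.sum_le_sum fun j _ => ?_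
  rw [dotProduct]
  have h1 : |x i * x j| ≤ ∑ l, x l * x l := by
    rw [abs_le]
    constructor <;> nlinarith [hx i, hx j, sq_nonneg (x i + x j), sq_nonneg (x i - x j)]
  calc x i * (S i j * x j) ≤ |x i * (S i j * x j)| := le_abs_self _
    _ = |S i j| * |x i * x j| := by rw [← abs_mul]; ring_nf
    _ ≤ _ := by gcongr

/-- The largest eigenvalue is continuous only on symmetric matrices; precomposing with
symmetrization gives a function continuous on all matrices. -/
lemma continuous_largestEigenvalue_symmetrization :
    Continuous fun M : Matrix (Fin n) (Fin n) ℝ =>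
      largestEigenvalue ((1 / 2 : ℝ) • (M + M.transpose)) := by
  rcases Nat.eq_zero_or_pos n with rfl | hn
  · exact continuous_of_const fun M N => by rw [Subsingleton.elim M N]
  set F : Matrix (Fin n) (Fin n) ℝ → Matrix (Fin n) (Fin n) ℝ :=
    fun M => (1 / 2 : ℝ) • (M + M.transpose) with hF
  have hFs : ∀ M, (F M).IsSymm := fun M => by
    simp only [hF, IsSymm, transpose_smul, transpose_add, transpose_transpose, add_comm]
  have hFc : Continuous F := by fun_prop
  have hle : ∀ M N, largestEigenvalue (F M) ≤
      largestEigenvalue (F N) + ∑ i, ∑ j, |F M i j - F N i j| := by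
    intro M N
    have := largestEigenvalue_add_le hn (hFs N) ((hFs M).sub (hFs N))
      (dotProduct_mulVec_le_sum_abs (F M - F N))
    simpa using this
  rw [continuous_iff_continuousAt]
  intro N
  have hd : Tendsto (fun M => ∑ i, ∑ j, |F M i j - F N i j|) (𝓝 N) (𝓝 0) := by
    have : Continuous fun M => ∑ i, ∑ j, |F M i j - F N i j| := by fun_prop
    simpa using this.tendsto N
  refine tendsto_of_tendsto_of_tendsto_of_le_of_le
    (g := fun M => largestEigenvalue (F N) - ∑ i, ∑ j, |F M i j - F N i j|)
    (h := fun M => largestEigenvalue (F N) + ∑ i, ∑ j, |F M i j - F N i j|) ?_ ?_ ?_ ?_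
  · simpa only [sub_zero] using hd.const_sub (largestEigenvalue (F N))
  · simpa only [add_zero] using hd.const_add (largestEigenvalue (F N))
  · intro M
    have := hle N M
    simp only [abs_sub_comm] at this ⊢
    linarith
  · exact fun M => hle M N

/-! ### A rank one perturbation of a sparse matrix -/

/-- Let `B` be a symmetric matrix with at most one nonzero entry in each row, supported on the rows
in `V`, and let `v` be a unit vector with little mass on `V`. Then `θ v vᵀ` and `B` almost act on
orthogonal subspaces, so that the quadratic form of `B + θ v vᵀ` is at most `max θ m` up to a small
error, where `m` bounds the entries of `B`. -/
lemma dotProduct_sparse_add_rankOne_le {B : Matrix (Fin n) (Fin n) ℝ} {V : Finset (Fin n)}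
    {v : Fin n → ℝ} {θ m η : ℝ} (hθ : 0 ≤ θ) (hm : 0 ≤ m) (hη : 0 ≤ η) (hη1 : η ≤ 1)
    (hB : B.IsSymm) (hrow : ∀ i j k, B i j ≠ 0 → B i k ≠ 0 → j = k)
    (hV : ∀ i j, B i j ≠ 0 → i ∈ V) (hBm : ∀ i j, |B i j| ≤ m) (hv : ∑ i, v i ^ 2 = 1)
    (hvV : ∑ i ∈ V, v i ^ 2 ≤ η ^ 2) (x : Fin n → ℝ) :
    x ⬝ᵥ (B + θ • vecMulVec v v) *ᵥ x ≤ (max θ m + 3 * θ * η) * (x ⬝ᵥ x) := by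
  set s : ℝ := ∑ i ∈ V, x i ^ 2 with hs
  set s' : ℝ := ∑ i ∈ Vᶜ, x i ^ 2 with hs'
  have hs0 : 0 ≤ s := Finset.sum_nonneg fun i _ => sq_nonneg _
  have hs0' : 0 ≤ s' := Finset.sum_nonneg fun i _ => sq_nonneg _
  have hss : x ⬝ᵥ x = s + s' := by
    rw [hs, hs', Finset.sum_add_sum_compl, dotProduct]
    exact Finset.sum_congr rfl fun i _ => by ring
  have hrowsum : ∀ i, ∑ j, |B i j| ≤ if i ∈ V then m else 0 := by
    intro i
    by_cases h : ∃ j, B i j ≠ 0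
    · obtain ⟨j, hj⟩ := h
      rw [if_pos (hV i j hj), Finset.sum_eq_single j]
      · exact hBm i j
      · intro k _ hk
        by_contra hne
        exact hk (hrow i k j (by simpa using hne) hj)
      · simp
    · push Not at h
      simp only [h, abs_zero, Finset.sum_const_zero]
      split_ifs <;> simp [hm]
  have hBx : x ⬝ᵥ B *ᵥ x ≤ m * s := by
    have h1 : x ⬝ᵥ B *ᵥ x ≤ ∑ i, ∑ j, (|B i j| * x i ^ 2 + |B i j| * x j ^ 2) / 2 := by
      simp only [dotProduct, mulVec, Finset.mul_sum]
      refine Finset.sum_le_sum fun i _ => Finset.sum_le_sum fun j _ => ?_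
      have h2 := abs_nonneg (B i j)
      have h3 : x i * (B i j * x j) ≤ |B i j| * (|x i| * |x j|) := by
        rw [← abs_mul, ← abs_mul]
        refine le_trans (le_abs_self _) (le_of_eq ?_)
        ring_nf
      nlinarith [sq_nonneg (|x i| - |x j|), sq_abs (x i), sq_abs (x j)]
    have h2 : ∑ i, ∑ j, (|B i j| * x i ^ 2 + |B i j| * x j ^ 2) / 2 =
        ∑ i, (∑ j, |B i j|) * x i ^ 2 := by
      have e1 : ∑ i, ∑ j, |B i j| * x j ^ 2 = ∑ i, ∑ j, |B i j| * x i ^ 2 := by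
        rw [Finset.sum_comm]
        exact Finset.sum_congr rfl fun i _ => Finset.sum_congr rfl fun j _ => by rw [hB.apply]
      simp only [Finset.sum_mul, ← Finset.sum_div, Finset.sum_add_distrib, e1]
      ring
    rw [h2] at h1
    refine h1.trans ?_
    have h3 : m * s = ∑ i, (if i ∈ V then m else 0) * x i ^ 2 := by
      simp [hs, Finset.mul_sum, ite_mul, Finset.sum_ite_mem]
    rw [h3]
    exact Finset.sum_le_sum fun i _ => mul_le_mul_of_nonneg_right (hrowsum i) (sq_nonneg _)
  set p : ℝ := ∑ i ∈ V, v i * x i with hp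
  set q : ℝ := ∑ i ∈ Vᶜ, v i * x i with hq
  have hpq : v ⬝ᵥ x = p + q := by rw [hp, hq, Finset.sum_add_sum_compl, dotProduct]
  have hvx : x ⬝ᵥ (θ • vecMulVec v v) *ᵥ x = θ * (p + q) ^ 2 := by
    rw [smul_mulVec, dotProduct_smul, vecMulVec_mulVec, dotProduct_smul, dotProduct_comm x v, hpq]
    simp only [smul_eq_mul, MulOpposite.smul_eq_mul_unop, MulOpposite.unop_op]
    ring
  have hp2 : p ^ 2 ≤ η ^ 2 * s := (Finset.sum_mul_sq_le_sq_mul_sq V v x).trans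
    (mul_le_mul_of_nonneg_right hvV hs0)
  have hq2 : q ^ 2 ≤ s' := by
    refine (Finset.sum_mul_sq_le_sq_mul_sq Vᶜ v x).trans ?_
    have : ∑ i ∈ Vᶜ, v i ^ 2 ≤ 1 := by
      rw [← hv]
      exact Finset.sum_le_univ_sum_of_nonneg fun i => sq_nonneg _
    nlinarith
  have hpq2 : p * q ≤ η * (s + s') := by
    refine abs_le_of_sq_le_sq' ?_ (by positivity) |>.2
    calc (p * q) ^ 2 = p ^ 2 * q ^ 2 := by ring
      _ ≤ (η ^ 2 * s) * s' := by gcongr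
      _ = η ^ 2 * (s * s') := by ring
      _ ≤ η ^ 2 * (s + s') ^ 2 := by gcongr; nlinarith [mul_nonneg hs0 hs0']
      _ = (η * (s + s')) ^ 2 := by ring
  have hsq : (p + q) ^ 2 ≤ s' + 3 * η * (s + s') := by
    have : η ^ 2 * s ≤ η * (s + s') := by nlinarith [mul_nonneg hη hs0, mul_nonneg hη hs0']
    nlinarith
  rw [add_mulVec, dotProduct_add, hvx, hss]
  calc x ⬝ᵥ B *ᵥ x + θ * (p + q) ^ 2 ≤ m * s + θ * (s' + 3 * η * (s + s')) := by gcongr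
    _ ≤ max θ m * s + (max θ m * s' + θ * (3 * η * (s + s'))) := by
      have h1 := mul_le_mul_of_nonneg_right (le_max_right θ m) hs0
      have h2 := mul_le_mul_of_nonneg_right (le_max_left θ m) hs0'
      linarith
    _ = _ := by ring

/-- Testing the quadratic form of `B + θ v vᵀ` on the part of `v` off the support of `B`. -/
lemma le_largestEigenvalue_sparse_add_rankOne {B : Matrix (Fin n) (Fin n) ℝ}
    {V : Finset (Fin n)} {v : Fin n → ℝ} {θ ε : ℝ} (hn : 0 < n) (hθ : 0 ≤ θ) (hε : ε < 1)
    (hB : B.IsSymm) (hV : ∀ i j, B i j ≠ 0 → i ∈ V) (hv : ∑ i, v i ^ 2 = 1)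
    (hvV : ∑ i ∈ V, v i ^ 2 ≤ ε) :
    θ * (1 - ε) ≤ largestEigenvalue (B + θ • vecMulVec v v) := by
  have hM : (B + θ • vecMulVec v v).IsSymm :=
    hB.add (by simp [IsSymm, transpose_smul, transpose_vecMulVec])
  set w : Fin n → ℝ := fun i => if i ∈ V then 0 else v i with hw
  have h := dotProduct_mulVec_le_largestEigenvalue hn hM w
  set e : ℝ := ∑ i ∈ V, v i ^ 2
  have hww : w ⬝ᵥ w = 1 - e := by
    rw [← hv, ← Finset.sum_add_sum_compl V, add_sub_cancel_left, dotProduct, ← Finset.sum_subset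
      (Finset.subset_univ Vᶜ)]
    · exact Finset.sum_congr rfl fun i hi => by
        simp only [hw, if_neg (Finset.mem_compl.1 hi)]; ring
    · intro i _ hi
      simp only [Finset.mem_compl, not_not] at hi
      simp [hw, hi]
  have hvw : v ⬝ᵥ w = 1 - e := by
    rw [← hww]
    refine Finset.sum_congr rfl fun i _ => ?_
    by_cases hi : i ∈ V <;> simp [hw, hi]
  have hBw : w ⬝ᵥ B *ᵥ w = 0 := by
    simp only [dotProduct, mulVec, Finset.mul_sum]
    refine Finset.sum_eq_zero fun i _ => Finset.sum_eq_zero fun j _ => ?_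
    by_cases hij : B i j = 0
    · simp [hij]
    · simp [hw, hV i j hij]
  have hvx : w ⬝ᵥ (θ • vecMulVec v v) *ᵥ w = θ * (1 - e) ^ 2 := by
    rw [smul_mulVec, dotProduct_smul, vecMulVec_mulVec, dotProduct_smul, dotProduct_comm w v, hvw]
    simp only [smul_eq_mul, MulOpposite.smul_eq_mul_unop, MulOpposite.unop_op]
    ring
  rw [add_mulVec, dotProduct_add, hBw, hvx, hww, zero_add, sq, ← mul_assoc] at h
  have h1 : θ * (1 - e) ≤ _ := le_of_mul_le_mul_right h (by linarith)
  refine le_trans ?_ h1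
  gcongr

/-- Testing the quadratic form of `B + θ v vᵀ` on `e_i ± e_j`. -/
lemma abs_le_largestEigenvalue_sparse_add_rankOne {B : Matrix (Fin n) (Fin n) ℝ}
    {v : Fin n → ℝ} {θ : ℝ} (hθ : 0 ≤ θ) (hB : B.IsSymm) (hdiag : ∀ i, B i i = 0) {i j : Fin n}
    (hij : i ≠ j) : |B i j| ≤ largestEigenvalue (B + θ • vecMulVec v v) := by
  have hn : 0 < n := i.pos
  have hM : (B + θ • vecMulVec v v).IsSymm :=
    hB.add (by simp [IsSymm, transpose_smul, transpose_vecMulVec])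
  obtain ⟨σ, hσ, hσB⟩ : ∃ σ : ℝ, σ * σ = 1 ∧ σ * B i j = |B i j| := by
    rcases le_total 0 (B i j) with h | h
    · exact ⟨1, by norm_num, by rw [abs_of_nonneg h, one_mul]⟩
    · exact ⟨-1, by norm_num, by rw [abs_of_nonpos h, neg_one_mul]⟩
  set w : Fin n → ℝ := Pi.single i 1 + Pi.single j σ with hw
  have h := dotProduct_mulVec_le_largestEigenvalue hn hM w
  have hww : w ⬝ᵥ w = 2 := by
    simp [hw, dotProduct_add, hij, hij.symm, hσ]
    norm_num
  have hBw : w ⬝ᵥ B *ᵥ w = 2 * |B i j| := by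
    simp [hw, mulVec_add, dotProduct_add, hdiag, ← hσB, hB.apply i j]
    ring
  have hvx : 0 ≤ w ⬝ᵥ (θ • vecMulVec v v) *ᵥ w := by
    rw [smul_mulVec, dotProduct_smul, vecMulVec_mulVec, dotProduct_smul, dotProduct_comm w v]
    simp only [smul_eq_mul, MulOpposite.smul_eq_mul_unop, MulOpposite.unop_op]
    exact mul_nonneg hθ (mul_self_nonneg _)
  rw [add_mulVec, dotProduct_add, hBw, hww] at h
  linarith

end Deterministic

/-! ### Walks in the complete graph and traces of powers -/

section Walks

/-- The edge used by the `t`-th step of the walk `w`. -/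
def walkEdge {α : Type*} {m : ℕ} (w : Fin (m + 1) → α) (t : Fin m) : Sym2 α :=
  s(w t.castSucc, w t.succ)

/-- The entries of `S ^ m` are sums over walks of length `m`. Testing against a function `g` of the
two end points lets the induction add a vertex at the front. -/
lemma sum_pow_apply_mul {n : ℕ} (S : Matrix (Fin n) (Fin n) ℝ) (m : ℕ)
    (g : Fin n → Fin n → ℝ) :
    ∑ i, ∑ j, (S ^ m) i j * g i j =
      ∑ w : Fin (m + 1) → Fin n,
        (∏ t : Fin m, S (w t.castSucc) (w t.succ)) * g (w 0) (w (Fin.last m)) := by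
  induction m generalizing g with
  | zero =>
    rw [← (Equiv.funUnique (Fin 1) (Fin n)).symm.sum_comp]
    refine Finset.sum_congr rfl fun i _ => ?_
    simp [Matrix.one_apply]
  | succ m ih =>
    rw [← (Fin.consEquiv fun _ => Fin n).sum_comp, Fintype.sum_prod_type]
    refine Finset.sum_congr rfl fun i _ => ?_
    have h := ih fun l j => S i l * g i j
    calc ∑ j, (S ^ (m + 1)) i j * g i j = ∑ l, ∑ j, (S ^ m) l j * (S i l * g i j) := by
          rw [Finset.sum_comm]
          refine Finset.sum_congr rfl fun j _ => ?_
          rw [pow_succ', Matrix.mul_apply, Finset.sum_mul]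
          exact Finset.sum_congr rfl fun l _ => by ring
      _ = _ := by
          rw [h]
          refine Finset.sum_congr rfl fun w _ => ?_
          rw [Fin.prod_univ_succ]
          simp only [Fin.consEquiv_apply, Fin.castSucc_zero, Fin.cons_zero, Fin.cons_succ,
            ← Fin.succ_castSucc, ← Fin.succ_last]
          ring

lemma trace_pow_eq_sum_walks {n : ℕ} (S : Matrix (Fin n) (Fin n) ℝ) (m : ℕ) :
    (S ^ m).trace = ∑ w : Fin (m + 1) → Fin n,
      (∏ t : Fin m, S (w t.castSucc) (w t.succ)) * if w 0 = w (Fin.last m) then 1 else 0 := by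
  rw [← sum_pow_apply_mul S m fun i j => if i = j then 1 else 0, Matrix.trace]
  refine Finset.sum_congr rfl fun i _ => ?_
  simp

/-- A walk visits at most one more vertex than it uses edges: each new vertex is reached through a
new edge. -/
lemma card_image_walk_le {α : Type*} [DecidableEq α] {m : ℕ} (w : Fin (m + 1) → α) :
    (Finset.univ.image w).card ≤ (Finset.univ.image (walkEdge w)).card + 1 := by
  induction m with
  | zero => exact Finset.card_image_le.trans (by simp)
  | succ m ih =>
    have hV : Finset.univ.image w = insert (w 0) (Finset.univ.image (Fin.tail w)) := by
      ext x
      simp [Fin.exists_fin_succ, Fin.tail, eq_comm]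
    have hE : Finset.univ.image (walkEdge w) =
        insert s(w 0, w 1) (Finset.univ.image (walkEdge (Fin.tail w))) := by
      ext z
      simp [Fin.exists_fin_succ, walkEdge, Fin.tail, eq_comm]
    have h := ih (Fin.tail w)
    rw [hV, hE]
    by_cases h0 : w 0 ∈ Finset.univ.image (Fin.tail w)
    · rw [Finset.insert_eq_of_mem h0]
      exact h.trans (Nat.succ_le_succ (Finset.card_le_card (Finset.subset_insert _ _)))
    · have h1 : s(w 0, w 1) ∉ Finset.univ.image (walkEdge (Fin.tail w)) := by
        intro hmem
        obtain ⟨t, -, ht⟩ := Finset.mem_image.1 hmem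
        have : w 0 ∈ walkEdge (Fin.tail w) t := ht ▸ Sym2.mem_mk_left _ _
        rcases Sym2.mem_iff.1 this with h2 | h2
        · exact h0 (h2 ▸ Finset.mem_image_of_mem _ (Finset.mem_univ _))
        · exact h0 (h2 ▸ Finset.mem_image_of_mem _ (Finset.mem_univ _))
      rw [Finset.card_insert_of_notMem h0, Finset.card_insert_of_notMem h1]
      omega

/-- Summing `n ^ (-|V|)` over all walks with `m` vertices, `V` being the set of visited vertices,
gives a quantity bounded independently of `n`. -/
lemma sum_inv_pow_card_image_le (n m : ℕ) :
    ∑ w : Fin m → Fin n, ((n : ℝ)⁻¹) ^ (Finset.univ.image w).card ≤ m.factorial := by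
  induction m with
  | zero => simp
  | succ m ih =>
    rw [← (Fin.consEquiv fun _ => Fin n).sum_comp, Fintype.sum_prod_type, Finset.sum_comm]
    have hstep : ∀ w : Fin m → Fin n,
        ∑ i : Fin n, ((n : ℝ)⁻¹) ^ (Finset.univ.image (Fin.consEquiv (fun _ => Fin n) (i, w))).card
          ≤ (m + 1) * ((n : ℝ)⁻¹) ^ (Finset.univ.image w).card := by
      intro w
      set V := Finset.univ.image w
      have himg : ∀ i, Finset.univ.image (Fin.consEquiv (fun _ => Fin n) (i, w)) = insert i V := by
        intro i
        ext x
        simp [Fin.exists_fin_succ, V, eq_comm]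
      have hn0 : (0 : ℝ) ≤ (n : ℝ)⁻¹ := by positivity
      calc ∑ i : Fin n, ((n : ℝ)⁻¹) ^
            (Finset.univ.image (Fin.consEquiv (fun _ => Fin n) (i, w))).card
          ≤ ∑ i : Fin n, ((if i ∈ V then ((n : ℝ)⁻¹) ^ V.card else 0) +
              ((n : ℝ)⁻¹) ^ (V.card + 1)) := by
            refine Finset.sum_le_sum fun i _ => ?_
            rw [himg]
            by_cases hi : i ∈ V
            · rw [Finset.insert_eq_of_mem hi, if_pos hi]
              exact le_add_of_nonneg_right (by positivity)
            · rw [Finset.card_insert_of_notMem hi, if_neg hi, zero_add]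
        _ = V.card * ((n : ℝ)⁻¹) ^ V.card + (n * (n : ℝ)⁻¹) * ((n : ℝ)⁻¹) ^ V.card := by
            rw [Finset.sum_add_distrib]
            simp only [Finset.sum_ite_mem, Finset.univ_inter, Finset.sum_const, nsmul_eq_mul,
              Finset.card_univ, Fintype.card_fin]
            ring
        _ ≤ m * ((n : ℝ)⁻¹) ^ V.card + 1 * ((n : ℝ)⁻¹) ^ V.card := by
            have h1 : V.card ≤ m := Finset.card_image_le.trans (by simp)
            have h2 : (n : ℝ) * (n : ℝ)⁻¹ ≤ 1 := mul_inv_le_one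
            gcongr
        _ = _ := by ring
    refine (Finset.sum_le_sum fun w _ => hstep w).trans ?_
    rw [← Finset.mul_sum, Nat.factorial_succ]
    push_cast
    gcongr

end Walks

/-! ### The moment method -/

section Moments

/-- The number of times the walk `w` uses the edge `z`. -/
def edgeMultiplicity {α : Type*} [DecidableEq α] {m : ℕ} (w : Fin (m + 1) → α) (z : Sym2 α) : ℕ :=
  (Finset.univ.filter fun t => walkEdge w t = z).card

/-- The contribution of a single walk of length `2k` to the expected trace. Here `φ` stands for the
moment sequence of the entries. A vanishing odd moment kills the walks using some edge an odd number
of times. Relative to `n ^ (-|V|)` and up to the factor `C ^ (2k)`, a walk using one edge only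
contributes at most `δ ^ (2k - 4)`, and any other walk contributes at most `q`: if some edge is used
four times or more, the factor `n⁻²` of this edge makes up for the extra vertex, and if all edges
are used exactly twice, the surplus `q ^ k` does. -/
lemma prod_moments_walk_le {n k : ℕ} (hn : 0 < n) (hk : 2 ≤ k) {φ : ℕ → ℝ} {C q δ : ℝ}
    (hC : 1 ≤ C) (hq1 : q ≤ 1) (hδ0 : 0 ≤ δ) (hδ1 : δ ≤ 1) (hnq : (n : ℝ)⁻¹ ≤ q)
    (hqk : q ^ k ≤ q * (n : ℝ)⁻¹)
    (hφ0 : φ 0 = 1) (hφodd : ∀ m, Odd m → φ m = 0) (hφnonneg : ∀ m, 0 ≤ φ m)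
    (hφ2 : φ 2 ≤ C * ((n : ℝ)⁻¹ * q))
    (hφ4 : ∀ m, 4 ≤ m → Even m → φ m ≤ C * δ ^ (m - 4) * ((n : ℝ)⁻¹) ^ 2)
    (w : Fin (2 * k + 1) → Fin n) :
    ∏ z, φ (edgeMultiplicity w z) ≤
      C ^ (2 * k) * (q + δ ^ (2 * k - 4)) * ((n : ℝ)⁻¹) ^ (Finset.univ.image w).card := by
  set L : ℝ := (n : ℝ)⁻¹ with hL
  have hL0 : 0 < L := by positivity
  have hL1 : L ≤ 1 := inv_le_one_of_one_le₀ (by exact_mod_cast hn)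
  have hq0 : 0 < q := hL0.trans_le hnq
  have hC0 : 0 < C := one_pos.trans_le hC
  have hδk : 0 ≤ δ ^ (2 * k - 4) := by positivity
  set E := Finset.univ.image (walkEdge w) with hE
  set μ := edgeMultiplicity w with hμ
  have hμ0 : ∀ z, z ∉ E → μ z = 0 := by
    intro z hz
    refine Finset.card_eq_zero.2 (Finset.filter_eq_empty_iff.2 fun t _ ht => hz ?_)
    exact ht ▸ Finset.mem_image_of_mem _ (Finset.mem_univ t)
  have hμpos : ∀ z ∈ E, 0 < μ z := by
    intro z hz
    obtain ⟨t, -, ht⟩ := Finset.mem_image.1 hz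
    exact Finset.card_pos.2 ⟨t, Finset.mem_filter.2 ⟨Finset.mem_univ t, ht⟩⟩
  have hprod : ∏ z, φ (μ z) = ∏ z ∈ E, φ (μ z) :=
    (Finset.prod_subset (Finset.subset_univ E) fun z _ hz => by rw [hμ0 z hz, hφ0]).symm
  have hsum : ∑ z ∈ E, μ z = 2 * k := by
    have := Finset.card_eq_sum_card_image (walkEdge w) Finset.univ
    rw [Finset.card_univ, Fintype.card_fin] at this
    exact this.symm
  rw [hprod]
  by_cases hodd : ∃ z ∈ E, Odd (μ z)
  · obtain ⟨z, hz, hzo⟩ := hodd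
    rw [Finset.prod_eq_zero hz (hφodd _ hzo)]
    positivity
  push Not at hodd
  have heven : ∀ z ∈ E, Even (μ z) := fun z hz => by
    simpa using hodd z hz
  have htwo : ∀ z ∈ E, 2 ≤ μ z := fun z hz => by
    obtain ⟨r, hr⟩ := heven z hz
    have := hμpos z hz
    omega
  have hφL2 : ∀ z ∈ E, μ z ≠ 2 → φ (μ z) ≤ C * L ^ 2 := by
    intro z hz hne
    obtain ⟨r, hr⟩ := heven z hz
    have h2 := htwo z hz
    refine (hφ4 (μ z) (by omega) (heven z hz)).trans ?_
    have : δ ^ (μ z - 4) ≤ 1 := pow_le_one₀ hδ0 hδ1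
    have h3 : C * δ ^ (μ z - 4) ≤ C := by nlinarith
    gcongr
  have hφqL : ∀ z ∈ E, φ (μ z) ≤ C * (L * q) := by
    intro z hz
    by_cases h2 : μ z = 2
    · rw [h2]; exact hφ2
    · refine (hφL2 z hz h2).trans ?_
      rw [sq]
      gcongr
  have hEk : E.card ≤ 2 * k := by
    refine Finset.card_image_le.trans ?_
    simp
  have hVE : (Finset.univ.image w).card ≤ E.card + 1 := card_image_walk_le w
  have hfinish : ∀ {Y : ℝ}, 0 ≤ Y → Y ≤ q + δ ^ (2 * k - 4) →
      C ^ E.card * (Y * L ^ (E.card + 1)) ≤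
        C ^ (2 * k) * (q + δ ^ (2 * k - 4)) * L ^ (Finset.univ.image w).card := by
    intro Y hY hYle
    rw [mul_assoc]
    have h1 : C ^ E.card ≤ C ^ (2 * k) := pow_le_pow_right₀ hC hEk
    have h2 : L ^ (E.card + 1) ≤ L ^ (Finset.univ.image w).card :=
      pow_le_pow_of_le_one hL0.le hL1 hVE
    gcongr
  by_cases hall : ∀ z ∈ E, μ z = 2
  · have hcard : E.card = k := by
      have : ∑ z ∈ E, μ z = E.card * 2 := by
        rw [Finset.sum_congr rfl hall, Finset.sum_const, smul_eq_mul]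
      omega
    refine le_trans ?_ (hfinish hq0.le (le_add_of_nonneg_right hδk))
    calc ∏ z ∈ E, φ (μ z) ≤ ∏ z ∈ E, C * (L * q) :=
          Finset.prod_le_prod (fun z _ => hφnonneg _) hφqL
      _ = C ^ E.card * (L ^ k * q ^ k) := by
          rw [Finset.prod_const, mul_pow, mul_pow, hcard]
      _ ≤ C ^ E.card * (L ^ k * (q * L)) := by gcongr
      _ = C ^ E.card * (q * L ^ (E.card + 1)) := by rw [hcard]; ring
  · push Not at hall
    obtain ⟨z, hz, hz2⟩ := hall
    rcases Nat.lt_or_ge E.card 2 with hlt | hge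
    · have hEz : E = {z} := by
        obtain ⟨y, hy⟩ := Finset.card_eq_one.1 (show E.card = 1 by
          have := Finset.card_pos.2 ⟨z, hz⟩
          omega)
        rw [hy] at hz ⊢
        rw [Finset.mem_singleton.1 hz]
      have hμz : μ z = 2 * k := by rwa [hEz, Finset.sum_singleton] at hsum
      refine le_trans ?_ (hfinish hδk (le_add_of_nonneg_left hq0.le))
      rw [hEz, Finset.prod_singleton, Finset.card_singleton, hμz, pow_one, ← mul_assoc]
      exact hφ4 (2 * k) (by omega) (even_two_mul k)
    · refine le_trans ?_ (hfinish hq0.le (le_add_of_nonneg_right hδk))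
      rw [← Finset.mul_prod_erase E _ hz]
      obtain ⟨e, he⟩ : ∃ e, E.card = e + 2 := ⟨E.card - 2, by omega⟩
      calc φ (μ z) * ∏ y ∈ E.erase z, φ (μ y)
          ≤ (C * L ^ 2) * ∏ y ∈ E.erase z, C * (L * q) := by
            refine mul_le_mul (hφL2 z hz hz2) ?_
              (Finset.prod_nonneg fun y _ => hφnonneg _) (by positivity)
            exact Finset.prod_le_prod (fun y _ => hφnonneg _)
              fun y hy => hφqL y (Finset.mem_of_mem_erase hy)
        _ = C ^ E.card * (q ^ (e + 1) * L ^ (E.card + 1)) := by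
            rw [Finset.prod_const, Finset.card_erase_of_mem hz, he]
            simp only [show e + 2 - 1 = e + 1 by omega]
            ring
        _ ≤ C ^ E.card * (q * L ^ (E.card + 1)) := by
            have : q ^ (e + 1) ≤ q := by
              rw [pow_succ]
              exact mul_le_of_le_one_left hq0.le (pow_le_one₀ hq0.le hq1)
            gcongr

/-- The expected trace of an even power of a symmetric matrix with bounded independent entries, in
terms of bounds on the moments `φ m = E[s ^ m]` of the entries. -/
lemma integral_trace_pow_le {Ω : Type*} [MeasurableSpace Ω] {P : Measure Ω}
    [IsProbabilityMeasure P] {n k : ℕ} (hn : 0 < n) (hk : 2 ≤ k)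
    {S : Ω → Matrix (Fin n) (Fin n) ℝ} {s : Sym2 (Fin n) → Ω → ℝ}
    (hSs : ∀ ω i j, S ω i j = s s(i, j) ω) (hs : ∀ z, AEMeasurable (s z) P)
    (hbdd : ∀ z ω, |s z ω| ≤ 1) (hindep : iIndepFun s P) {φ : ℕ → ℝ}
    (hφ : ∀ z m, ∫ ω, s z ω ^ m ∂P = φ m) {C q δ : ℝ}
    (hC : 1 ≤ C) (hq1 : q ≤ 1) (hδ0 : 0 ≤ δ) (hδ1 : δ ≤ 1) (hnq : (n : ℝ)⁻¹ ≤ q)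
    (hqk : q ^ k ≤ q * (n : ℝ)⁻¹) (hφodd : ∀ m, Odd m → φ m = 0)
    (hφ2 : φ 2 ≤ C * ((n : ℝ)⁻¹ * q))
    (hφ4 : ∀ m, 4 ≤ m → Even m → φ m ≤ C * δ ^ (m - 4) * ((n : ℝ)⁻¹) ^ 2) :
    Integrable (fun ω => (S ω ^ (2 * k)).trace) P ∧
    ∫ ω, (S ω ^ (2 * k)).trace ∂P ≤
      C ^ (2 * k) * (q + δ ^ (2 * k - 4)) * (2 * k + 1).factorial := by
  have hprodeq : ∀ (w : Fin (2 * k + 1) → Fin n) ω,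
      ∏ t : Fin (2 * k), S ω (w t.castSucc) (w t.succ) = ∏ z, s z ω ^ edgeMultiplicity w z := by
    intro w ω
    simp only [hSs]
    rw [show ∏ t : Fin (2 * k), s s(w t.castSucc, w t.succ) ω =
        ∏ t : Fin (2 * k), (fun z => s z ω) (walkEdge w t) from rfl,
      Finset.prod_comp (fun z => s z ω) (walkEdge w)]
    refine Finset.prod_subset (Finset.subset_univ _) fun z _ hz => ?_
    have : (Finset.univ.filter fun t => walkEdge w t = z).card = 0 :=
      Finset.card_eq_zero.2 (Finset.filter_eq_empty_iff.2 fun t _ ht =>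
        hz (ht ▸ Finset.mem_image_of_mem _ (Finset.mem_univ t)))
    rw [this, pow_zero]
  have hint : ∀ w : Fin (2 * k + 1) → Fin n,
      Integrable (fun ω => ∏ t : Fin (2 * k), S ω (w t.castSucc) (w t.succ)) P := by
    intro w
    refine Integrable.of_bound (AEMeasurable.aestronglyMeasurable ?_) 1 (ae_of_all _ fun ω => ?_)
    · simp only [hSs]
      exact Finset.aemeasurable_fun_prod _ fun t _ => hs _
    · rw [Real.norm_eq_abs, Finset.abs_prod]
      exact Finset.prod_le_one (fun _ _ => abs_nonneg _) fun t _ => by rw [hSs]; exact hbdd _ _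
  have hexp : ∀ w : Fin (2 * k + 1) → Fin n,
      ∫ ω, ∏ t : Fin (2 * k), S ω (w t.castSucc) (w t.succ) ∂P =
        ∏ z, φ (edgeMultiplicity w z) := by
    intro w
    simp only [hprodeq]
    rw [hindep.integral_fun_prod_comp (f := fun z x => x ^ edgeMultiplicity w z) hs
      fun z => by fun_prop]
    exact Finset.prod_congr rfl fun z _ => hφ z _
  have hφnonneg : 0 < n → ∀ m, 0 ≤ φ m := by
    intro hn m
    rcases Nat.even_or_odd m with hm | hm
    · rw [← hφ s(⟨0, hn⟩, ⟨0, hn⟩) m]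
      exact integral_nonneg fun ω => hm.pow_nonneg _
    · rw [hφodd m hm]
  have hφ0 : φ 0 = 1 := by
    rw [← hφ s(⟨0, hn⟩, ⟨0, hn⟩) 0]
    simp
  simp only [trace_pow_eq_sum_walks]
  refine ⟨integrable_finsetSum _ fun w _ => (hint w).mul_const _, ?_⟩
  rw [integral_finsetSum _ fun w _ => (hint w).mul_const _]
  have hL0 : (0 : ℝ) < (n : ℝ)⁻¹ := by positivity
  have hq0 : 0 < q := hL0.trans_le hnq
  calc ∑ w : Fin (2 * k + 1) → Fin n,
        ∫ ω, (∏ t : Fin (2 * k), S ω (w t.castSucc) (w t.succ)) *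
          (if w 0 = w (Fin.last (2 * k)) then 1 else 0) ∂P
      ≤ ∑ w : Fin (2 * k + 1) → Fin n, C ^ (2 * k) * (q + δ ^ (2 * k - 4)) *
          ((n : ℝ)⁻¹) ^ (Finset.univ.image w).card := by
        refine Finset.sum_le_sum fun w _ => ?_
        rw [integral_mul_const, hexp]
        have h1 := prod_moments_walk_le hn hk hC hq1 hδ0 hδ1 hnq hqk hφ0 hφodd (hφnonneg hn)
          hφ2 hφ4 w
        have h2 : 0 ≤ ∏ z, φ (edgeMultiplicity w z) :=
          Finset.prod_nonneg fun z _ => hφnonneg hn _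
        split_ifs
        · rwa [mul_one]
        · rw [mul_zero]
          exact h2.trans h1
    _ ≤ _ := by
        rw [← Finset.mul_sum]
        have := sum_inv_pow_card_image_le n (2 * k + 1)
        gcongr

end Moments

/-! ### Truncated entries -/

/-- The contribution `(t / b) 1(|t| ≤ δ b)` of an entry `t` to the small part of the normalized
matrix. -/
noncomputable def smallPart (b δ t : ℝ) : ℝ := {t : ℝ | |t| ≤ δ * b}.indicator (fun t => t / b) t

/-- The contribution `(t / b) 1(|t| > δ b)` of an entry `t` to the large part of the normalized
matrix. -/
noncomputable def largePart (b δ t : ℝ) : ℝ := {t : ℝ | δ * b < |t|}.indicator (fun t => t / b) t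

lemma largePart_add_smallPart (b δ t : ℝ) : largePart b δ t + smallPart b δ t = b⁻¹ * t := by
  rcases le_or_gt |t| (δ * b) with h | h
  · simp [largePart, smallPart, h, not_lt.2 h, div_eq_inv_mul]
  · simp [largePart, smallPart, h, not_le.2 h, div_eq_inv_mul]

lemma measurable_smallPart (b δ : ℝ) : Measurable (smallPart b δ) :=
  (measurable_id.div_const b).indicator
    (measurableSet_le continuous_abs.measurable measurable_const)

lemma abs_smallPart_le {b δ : ℝ} (hb : 0 < b) (hδ : 0 ≤ δ) (t : ℝ) : |smallPart b δ t| ≤ δ := by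
  rcases le_or_gt |t| (δ * b) with h | h
  · simp [smallPart, h, abs_div, abs_of_pos hb, div_le_iff₀ hb]
  · simp [smallPart, not_le.2 h, hδ]

lemma smallPart_neg (b δ t : ℝ) : smallPart b δ (-t) = -smallPart b δ t := by
  by_cases h : |t| ≤ δ * b <;> simp [smallPart, h, neg_div]

lemma lt_abs_of_largePart_ne_zero {b δ t : ℝ} (h : largePart b δ t ≠ 0) : δ * b < |t| := by
  by_contra hcon
  exact h (by simp [largePart, hcon])

lemma integral_smallPart_pow_odd {μ : Measure ℝ} (hsymm : IsSymmetricLaw μ) (b δ : ℝ) {m : ℕ}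
    (hm : Odd m) : ∫ t, smallPart b δ t ^ m ∂μ = 0 := by
  have h : ∫ t, smallPart b δ t ^ m ∂μ = -∫ t, smallPart b δ t ^ m ∂μ := by
    conv_lhs => rw [← hsymm]
    rw [integral_map measurable_neg.aemeasurable
      ((measurable_smallPart b δ).pow_const m).aestronglyMeasurable, ← integral_neg]
    simp only [smallPart_neg, hm.neg_pow]
  linarith

lemma integral_smallPart_pow_even_le {μ : Measure ℝ} [IsProbabilityMeasure μ] {b δ : ℝ}
    (hb : 0 < b) (hδ0 : 0 ≤ δ) (hδ1 : δ ≤ 1) {p m : ℕ} (hp0 : p ≠ 0) (hp : Even p)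
    (hm : Even m) (hpm : p ≤ m) :
    ∫ t, smallPart b δ t ^ m ∂μ ≤ δ ^ (m - p) * (truncatedMoment μ p b / b ^ p) := by
  rw [truncatedMoment, ← integral_div, ← integral_const_mul]
  refine integral_mono ?_ (((integrable_abs_pow_indicator μ p b).div_const _).const_mul _)
    fun t => ?_
  · refine Integrable.of_bound ((measurable_smallPart b δ).pow_const m).aestronglyMeasurable
      (δ ^ m) (ae_of_all _ fun t => ?_)
    rw [norm_pow, Real.norm_eq_abs]
    exact pow_le_pow_left₀ (abs_nonneg _) (abs_smallPart_le hb hδ0 t) m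
  · obtain ⟨r, rfl⟩ := Nat.exists_eq_add_of_le hpm
    have hr : Even r := by
      rcases Nat.even_or_odd r with h | h
      · exact h
      · exact absurd (hp.add_odd h) (Nat.not_odd_iff_even.2 hm)
    have h1 : smallPart b δ t ^ r ≤ δ ^ r := by
      rw [← hr.pow_abs]
      exact pow_le_pow_left₀ (abs_nonneg _) (abs_smallPart_le hb hδ0 t) r
    have h2 : smallPart b δ t ^ p ≤ {t : ℝ | |t| ≤ b}.indicator (fun t => |t| ^ p) t / b ^ p := by
      rcases le_or_gt |t| (δ * b) with h | h
      · have h3 : |t| ≤ b := h.trans (mul_le_of_le_one_left hb.le hδ1)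
        simp [smallPart, h, h3, div_pow, hp.pow_abs]
      · have h3 : smallPart b δ t = 0 := by simp [smallPart, not_le.2 h]
        rw [h3, zero_pow hp0]
        exact div_nonneg (Set.indicator_nonneg (fun _ _ => by positivity) t) (by positivity)
    simp only [Nat.add_sub_cancel_left]
    rw [pow_add, mul_comm]
    exact mul_le_mul h1 h2 (hp.pow_nonneg _) (by positivity)

/-! ### The entries of a Wigner matrix, indexed by unordered pairs -/

section Wigner

variable {Ω : Type*} [MeasurableSpace Ω] {P : Measure Ω} {μ : Measure ℝ} {n : ℕ}
  {A : Ω → Matrix (Fin n) (Fin n) ℝ}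

/-- The entry of `A` at the position given by the unordered pair `z`, read off on or above the
diagonal. -/
def pairEntry (A : Ω → Matrix (Fin n) (Fin n) ℝ) (z : Sym2 (Fin n)) (ω : Ω) : ℝ :=
  A ω (Sym2.sortEquiv z).1.1 (Sym2.sortEquiv z).1.2

lemma IsWignerMatrix.apply_eq (hA : IsWignerMatrix A μ P) (ω : Ω) (i j : Fin n) :
    A ω i j = pairEntry A s(i, j) ω := by
  rcases le_total i j with h | h
  · simp [pairEntry, Sym2.sortEquiv, h]
  · rw [← (hA.symm ω).apply i j]
    simp [pairEntry, Sym2.sortEquiv, h]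

lemma IsWignerMatrix.hasLaw_pairEntry (hA : IsWignerMatrix A μ P) (z : Sym2 (Fin n)) :
    HasLaw (pairEntry A z) μ P :=
  hA.hasLaw _ _ (Sym2.sortEquiv z).2

lemma IsWignerMatrix.iIndepFun_pairEntry (hA : IsWignerMatrix A μ P) :
    iIndepFun (pairEntry A) P :=
  iIndepFun.precomp (g := Sym2.sortEquiv) Sym2.sortEquiv.injective hA.indep

lemma perturbedMatrix_isSymm (hA : IsWignerMatrix A μ P) (b θ : ℝ)
    (v : EuclideanSpace ℝ (Fin n)) (ω : Ω) : (perturbedMatrix b θ v (A ω)).IsSymm := by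
  have := (hA.symm ω).eq
  simp [perturbedMatrix, Matrix.IsSymm, Matrix.transpose_smul, Matrix.transpose_vecMulVec, this]

lemma aemeasurable_largestEigenvalue (hA : IsWignerMatrix A μ P) (b θ : ℝ)
    (v : EuclideanSpace ℝ (Fin n)) :
    AEMeasurable (fun ω => largestEigenvalue (perturbedMatrix b θ v (A ω))) P := by
  have hM : AEMeasurable (fun ω i j => perturbedMatrix b θ v (A ω) i j) P := by
    refine aemeasurable_pi_iff.2 fun i => aemeasurable_pi_iff.2 fun j => ?_
    simp only [perturbedMatrix, Matrix.add_apply, Matrix.smul_apply, smul_eq_mul, hA.apply_eq]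
    exact ((hA.hasLaw_pairEntry _).aemeasurable.const_mul _).add_const _
  have hc : Continuous fun M : Fin n → Fin n → ℝ =>
      largestEigenvalue ((1 / 2 : ℝ) • (Matrix.of M + (Matrix.of M).transpose)) :=
    continuous_largestEigenvalue_symmetrization
  refine (hc.measurable.comp_aemeasurable hM).congr (ae_of_all _ fun ω => ?_)
  have h := (perturbedMatrix_isSymm hA b θ v ω).eq
  change largestEigenvalue ((1 / 2 : ℝ) • (perturbedMatrix b θ v (A ω) +
    (perturbedMatrix b θ v (A ω)).transpose)) = _
  rw [h, ← two_smul ℝ, smul_smul]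
  norm_num

/-! ### The small entries -/

/-- The quadratic form of the small part of the matrix is small with high probability, by Markov's
inequality for the trace of the `2k`-th power. -/
lemma measureReal_small_quadForm_le [IsProbabilityMeasure P] [IsProbabilityMeasure μ]
    (hsymm : IsSymmetricLaw μ) (hA : IsWignerMatrix A μ P) {b δ ρ C q : ℝ} {k : ℕ} (hn : 0 < n)
    (hk : 2 ≤ k) (hb : 0 < b) (hδ0 : 0 ≤ δ) (hδ1 : δ ≤ 1) (hρ : 0 < ρ)
    (hC : 1 ≤ C) (hq1 : q ≤ 1) (hnq : (n : ℝ)⁻¹ ≤ q) (hqk : q ^ k ≤ q * (n : ℝ)⁻¹)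
    (hm2 : truncatedMoment μ 2 b ≤ C * (b ^ 2 * ((n : ℝ)⁻¹ * q)))
    (hm4 : truncatedMoment μ 4 b ≤ C * (b ^ 4 * ((n : ℝ)⁻¹) ^ 2)) :
    P.real {ω | ¬ ∀ x : Fin n → ℝ,
        |x ⬝ᵥ ((A ω).map (smallPart b δ)).mulVec x| ≤ ρ * (x ⬝ᵥ x)} ≤
      C ^ (2 * k) * (q + δ ^ (2 * k - 4)) * (2 * k + 1).factorial / ρ ^ (2 * k) := by
  set S : Ω → Matrix (Fin n) (Fin n) ℝ := fun ω => (A ω).map (smallPart b δ)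
  have hSsymm : ∀ ω, (S ω).IsSymm := fun ω => (hA.symm ω).map _
  have hmeas := measurable_smallPart b δ
  obtain ⟨hint, hle⟩ := integral_trace_pow_le (P := P) (S := S)
    (s := fun z ω => smallPart b δ (pairEntry A z ω)) hn hk
    (fun ω i j => by simp only [S, Matrix.map_apply, hA.apply_eq])
    (fun z => hmeas.comp_aemeasurable (hA.hasLaw_pairEntry z).aemeasurable)
    (fun z ω => (abs_smallPart_le hb hδ0 _).trans hδ1)
    (hA.iIndepFun_pairEntry.comp (fun _ => smallPart b δ) fun _ => hmeas)
    (φ := fun m => ∫ t, smallPart b δ t ^ m ∂μ)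
    (fun z m => (hA.hasLaw_pairEntry z).integral_comp (f := fun t => smallPart b δ t ^ m)
      (hmeas.pow_const m).aestronglyMeasurable)
    hC hq1 hδ0 hδ1 hnq hqk (fun m hm => integral_smallPart_pow_odd hsymm b δ hm)
    (by
      refine (integral_smallPart_pow_even_le hb hδ0 hδ1 two_ne_zero even_two even_two
        le_rfl).trans ?_
      rw [Nat.sub_self, pow_zero, one_mul, div_le_iff₀ (by positivity)]
      linarith)
    (fun m hm4' hme => by
      refine (integral_smallPart_pow_even_le hb hδ0 hδ1 four_ne_zero (by decide) hme hm4').trans ?_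
      rw [mul_comm C, mul_assoc]
      refine mul_le_mul_of_nonneg_left ?_ (by positivity)
      rw [div_le_iff₀ (by positivity)]
      linarith)
  have hnonneg : ∀ ω, 0 ≤ (S ω ^ (2 * k)).trace := by
    intro ω
    rw [two_mul, pow_add, Matrix.trace]
    refine Finset.sum_nonneg fun i _ => ?_
    rw [Matrix.diag_apply, Matrix.mul_apply]
    refine Finset.sum_nonneg fun j _ => ?_
    rw [((hSsymm ω).pow k).apply i j]
    exact mul_self_nonneg _
  have hmarkov := mul_meas_ge_le_integral_of_nonneg (ae_of_all _ hnonneg) hint (ρ ^ (2 * k))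
  rw [le_div_iff₀ (by positivity), mul_comm]
  refine le_trans ?_ (hmarkov.trans hle)
  refine mul_le_mul_of_nonneg_left (measureReal_mono fun ω hω => ?_) (by positivity)
  by_contra hlt
  exact hω fun x => abs_dotProduct_mulVec_le_of_trace hn (hSsymm ω) (by omega) hρ.le
    (not_le.1 hlt).le x

/-! ### The large entries -/

lemma measureReal_lt_abs_le [IsProbabilityMeasure P] [IsProbabilityMeasure μ]
    (hA : IsWignerMatrix A μ P) (y : ℝ) (z : Sym2 (Fin n)) :
    P.real {ω | y < |pairEntry A z ω|} ≤ absTail μ y := by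
  rw [(hA.hasLaw_pairEntry z).measureReal_eq (p := fun t => y < |t|)
    (measurableSet_lt measurable_const continuous_abs.measurable)]
  exact measureReal_mono fun t (ht : y < |t|) => show y ≤ |t| from ht.le

lemma nullMeasurableSet_lt_abs (hA : IsWignerMatrix A μ P) (y : ℝ) (z : Sym2 (Fin n)) :
    NullMeasurableSet {ω | y < |pairEntry A z ω|} P :=
  (hA.hasLaw_pairEntry z).aemeasurable.nullMeasurable
    (measurableSet_lt measurable_const continuous_abs.measurable :
      MeasurableSet {t : ℝ | y < |t|})

/-- Two large entries in the same row, or a large entry on the diagonal, are unlikely. -/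
lemma measureReal_not_matching_le [IsProbabilityMeasure P] [IsProbabilityMeasure μ]
    (hA : IsWignerMatrix A μ P) (y : ℝ) :
    P.real {ω | (∃ i, y < |A ω i i|) ∨ ∃ i j k, j ≠ k ∧ y < |A ω i j| ∧ y < |A ω i k|} ≤
      n * absTail μ y + n ^ 3 * absTail μ y ^ 2 := by
  set T := absTail μ y
  have hT : 0 ≤ T := absTail_nonneg _ _
  have hpair : ∀ i j k, P.real {ω | j ≠ k ∧ y < |A ω i j| ∧ y < |A ω i k|} ≤ T ^ 2 := by
    intro i j k
    by_cases hjk : j = k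
    · simp only [hjk, ne_eq, not_true_eq_false, false_and]
      simpa using sq_nonneg T
    have hz : s(i, j) ≠ s(i, k) := fun h => hjk (Sym2.congr_right.1 h)
    have hind := (hA.iIndepFun_pairEntry.indepFun hz).measure_inter_preimage_eq_mul
      {t : ℝ | y < |t|} {t : ℝ | y < |t|}
      (measurableSet_lt measurable_const continuous_abs.measurable)
      (measurableSet_lt measurable_const continuous_abs.measurable)
    have hset : {ω | j ≠ k ∧ y < |A ω i j| ∧ y < |A ω i k|} =
        pairEntry A s(i, j) ⁻¹' {t : ℝ | y < |t|} ∩ pairEntry A s(i, k) ⁻¹' {t : ℝ | y < |t|} := by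
      ext ω
      simp [hjk, hA.apply_eq]
    rw [hset, Measure.real, hind, ENNReal.toReal_mul, sq]
    exact mul_le_mul (measureReal_lt_abs_le hA y _) (measureReal_lt_abs_le hA y _)
      ENNReal.toReal_nonneg hT
  have hset : {ω | (∃ i, y < |A ω i i|) ∨ ∃ i j k, j ≠ k ∧ y < |A ω i j| ∧ y < |A ω i k|} =
      (⋃ i, {ω | y < |pairEntry A s(i, i) ω|}) ∪
        ⋃ p : Fin n × Fin n × Fin n,
          {ω | p.2.1 ≠ p.2.2 ∧ y < |A ω p.1 p.2.1| ∧ y < |A ω p.1 p.2.2|} := by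
    ext ω
    simp [hA.apply_eq, Prod.exists]
  rw [hset]
  refine (measureReal_union_le _ _).trans (add_le_add ?_ ?_)
  · refine (measureReal_iUnion_fintype_le _).trans ?_
    refine (Finset.sum_le_sum fun i _ => measureReal_lt_abs_le hA y s(i, i)).trans ?_
    simp [T]
  · refine (measureReal_iUnion_fintype_le _).trans ?_
    refine (Finset.sum_le_sum fun p _ => hpair p.1 p.2.1 p.2.2).trans ?_
    simp only [Finset.sum_const, nsmul_eq_mul, Finset.card_univ, Fintype.card_prod,
      Fintype.card_fin]
    push_cast
    exact le_of_eq (by ring)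

/-- A deterministic unit vector has little mass on the rows containing a large entry. -/
lemma measureReal_mass_le [IsProbabilityMeasure P] [IsProbabilityMeasure μ]
    (hA : IsWignerMatrix A μ P) (y : ℝ) {v : Fin n → ℝ} (hv : ∑ i, v i ^ 2 = 1) {ε : ℝ}
    (hε : 0 < ε) :
    P.real {ω | ε ≤ ∑ i with ∃ j, y < |A ω i j|, v i ^ 2} ≤ n * absTail μ y / ε := by
  classical
  set Z : Ω → ℝ := fun ω =>
    ∑ i, ∑ j, v i ^ 2 * {ω | y < |pairEntry A s(i, j) ω|}.indicator (fun _ => (1 : ℝ)) ω with hZ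
  have hi1 : ∀ i j, Integrable ({ω | y < |pairEntry A s(i, j) ω|}.indicator fun _ => (1 : ℝ)) P :=
    fun i j => (integrable_const _).indicator₀ (nullMeasurableSet_lt_abs hA y _)
  have hZi : Integrable Z P :=
    integrable_finsetSum _ fun i _ => integrable_finsetSum _ fun j _ => (hi1 i j).const_mul _
  have hZ0 : ∀ ω, 0 ≤ Z ω := fun ω => Finset.sum_nonneg fun i _ => Finset.sum_nonneg fun j _ =>
    mul_nonneg (sq_nonneg _) (Set.indicator_nonneg (fun _ _ => zero_le_one) ω)
  have hZE : ∫ ω, Z ω ∂P ≤ n * absTail μ y := by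
    calc ∫ ω, Z ω ∂P = ∑ i, ∑ j, v i ^ 2 * P.real {ω | y < |pairEntry A s(i, j) ω|} := by
          rw [integral_finsetSum _ fun i _ => integrable_finsetSum _ fun j _ =>
            (hi1 i j).const_mul _]
          refine Finset.sum_congr rfl fun i _ => ?_
          rw [integral_finsetSum _ fun j _ => (hi1 i j).const_mul _]
          refine Finset.sum_congr rfl fun j _ => ?_
          rw [integral_const_mul, integral_indicator₀ (nullMeasurableSet_lt_abs hA y _)]
          simp
      _ ≤ ∑ i, ∑ _j : Fin n, v i ^ 2 * absTail μ y := by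
          gcongr
          exact measureReal_lt_abs_le hA y _
      _ = n * absTail μ y := by
          simp only [Finset.sum_const, Finset.card_univ, Fintype.card_fin, nsmul_eq_mul,
            ← Finset.mul_sum, ← Finset.sum_mul, hv, one_mul]
  rw [le_div_iff₀ hε, mul_comm]
  refine le_trans ?_ ((mul_meas_ge_le_integral_of_nonneg (ae_of_all _ hZ0) hZi ε).trans hZE)
  refine mul_le_mul_of_nonneg_left (measureReal_mono fun ω hω => ?_) hε.le
  refine le_trans (show ε ≤ _ from hω) ?_
  rw [Finset.sum_filter]
  refine Finset.sum_le_sum fun i _ => ?_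
  have hterm : ∀ j, 0 ≤ v i ^ 2 *
      {ω | y < |pairEntry A s(i, j) ω|}.indicator (fun _ => (1 : ℝ)) ω := fun j =>
    mul_nonneg (sq_nonneg _) (Set.indicator_nonneg (fun _ _ => zero_le_one) ω)
  split_ifs with h
  · obtain ⟨j, hj⟩ := h
    refine le_trans ?_ (Finset.single_le_sum (fun j _ => hterm j) (Finset.mem_univ j))
    rw [hA.apply_eq] at hj
    rw [Set.indicator_of_mem (show ω ∈ {ω | y < |pairEntry A s(i, j) ω|} from hj), mul_one]
  · exact Finset.sum_nonneg fun j _ => hterm j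

end Wigner

/-! ### Comparison of the largest eigenvalue with the largest entry -/

section Comparison

variable {Ω : Type*} [MeasurableSpace Ω] {P : Measure Ω} {μ : Measure ℝ} {n : ℕ}
  {A : Ω → Matrix (Fin n) (Fin n) ℝ}

/-- `IsCloseToMax b θ ρ v M` expresses, through inequalities between thresholds, that the largest
eigenvalue of `b⁻¹ M + θ v vᵀ` is within `ρ` of `max θ (max |M i j| / b)`. -/
structure IsCloseToMax (b θ ρ : ℝ) (v : EuclideanSpace ℝ (Fin n)) (M : Matrix (Fin n) (Fin n) ℝ) :
    Prop where
  theta_le : θ - ρ ≤ largestEigenvalue (perturbedMatrix b θ v M)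
  le_of_entries_lt : ∀ y, θ ≤ y → (∀ i j, |M i j| < y * b) →
    largestEigenvalue (perturbedMatrix b θ v M) ≤ y + ρ
  entries_le : ∀ y, θ ≤ y → largestEigenvalue (perturbedMatrix b θ v M) ≤ y →
    ∀ i j, |M i j| ≤ (y + ρ) * b

open Matrix in
/-- The deterministic comparison: the matrix is split into its large and its small entries. The
small part shifts the largest eigenvalue by at most `ρ`; the large part and `θ v vᵀ` hardly
interact. -/
lemma isCloseToMax_of_matching {M : Matrix (Fin n) (Fin n) ℝ} (hM : M.IsSymm)
    {b θ δ η ρ : ℝ} {v : EuclideanSpace ℝ (Fin n)} (hn : 0 < n) (hb : 0 < b) (hθ : 0 < θ)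
    (hδ : δ ≤ θ) (hη0 : 0 < η) (hη1 : η < 1) (hηρ : 3 * θ * η ≤ ρ)
    (hv : ∑ i, v i ^ 2 = 1)
    (hmatch : ¬ ((∃ i, δ * b < |M i i|) ∨
      ∃ i j k, j ≠ k ∧ δ * b < |M i j| ∧ δ * b < |M i k|))
    (hmass : ∑ i with ∃ j, δ * b < |M i j|, v i ^ 2 ≤ η ^ 2)
    (hsmall : ∀ x : Fin n → ℝ, |x ⬝ᵥ (M.map (smallPart b δ)) *ᵥ x| ≤ ρ * (x ⬝ᵥ x)) :
    IsCloseToMax b θ (2 * ρ) v M := by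
  classical
  push Not at hmatch
  obtain ⟨hdiag, hrow⟩ := hmatch
  set B := M.map (largePart b δ) with hB
  set S := M.map (smallPart b δ) with hS
  set u : Fin n → ℝ := fun i => v i with hu
  set V : Finset (Fin n) := Finset.univ.filter fun i => ∃ j, δ * b < |M i j| with hV
  have hBs : B.IsSymm := hM.map _
  have hSs : S.IsSymm := hM.map _
  have hW : (B + θ • vecMulVec u u).IsSymm :=
    hBs.add (by simp [IsSymm, transpose_smul, transpose_vecMulVec])
  have hdec : perturbedMatrix b θ v M = (B + θ • vecMulVec u u) + S := by
    ext i j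
    simp only [perturbedMatrix, Matrix.add_apply, Matrix.smul_apply, smul_eq_mul, hB, hS, map_apply,
      ← largePart_add_smallPart b δ (M i j)]
    ring
  have hBlarge : ∀ i j, B i j ≠ 0 → δ * b < |M i j| := fun i j h =>
    lt_abs_of_largePart_ne_zero h
  have hBrow : ∀ i j k, B i j ≠ 0 → B i k ≠ 0 → j = k := by
    intro i j k hj hk
    by_contra hjk
    exact absurd (hrow i j k hjk (hBlarge i j hj)) (not_le.2 (hBlarge i k hk))
  have hBV : ∀ i j, B i j ≠ 0 → i ∈ V := fun i j h =>
    Finset.mem_filter.2 ⟨Finset.mem_univ i, j, hBlarge i j h⟩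
  have hBdiag : ∀ i, B i i = 0 := fun i => by
    by_contra h
    exact absurd (hdiag i) (not_le.2 (hBlarge i i h))
  have hBle : ∀ i j, |B i j| ≤ |M i j| / b := by
    intro i j
    rw [hB, map_apply, largePart]
    by_cases h : δ * b < |M i j|
    · simp [h, abs_div, abs_of_pos hb]
    · simp only [Set.mem_ofPred_eq, h, not_false_eq_true, Set.indicator_of_notMem, abs_zero]
      positivity
  have hρ : 0 ≤ ρ := le_trans (by positivity) hηρ
  set l := largestEigenvalue (perturbedMatrix b θ v M) with hl
  set l' := largestEigenvalue (B + θ • vecMulVec u u) with hl'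
  have hup : l ≤ l' + ρ := by
    rw [hl, hdec]
    exact largestEigenvalue_add_le hn hW hSs fun x => (le_abs_self _).trans (hsmall x)
  have hdown : l' ≤ l + ρ := by
    have h := largestEigenvalue_add_le (S := -S) hn (hW.add hSs) hSs.neg (ρ := ρ) fun x => by
      rw [neg_mulVec, dotProduct_neg]
      exact (neg_le_abs _).trans (hsmall x)
    rw [add_neg_cancel_right, ← hdec] at h
    exact h
  refine ⟨?_, fun y hy hlt => ?_, fun y hy hly i j => ?_⟩
  · have h := le_largestEigenvalue_sparse_add_rankOne hn hθ.le (by nlinarith : η ^ 2 < 1) hBs hBV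
      hv hmass
    have h2 : η ^ 2 ≤ η := by nlinarith
    nlinarith
  · have hy0 : 0 < y := hθ.trans_le hy
    have h : l' ≤ max θ y + 3 * θ * η := largestEigenvalue_le hn hW fun x =>
      dotProduct_sparse_add_rankOne_le hθ.le hy0.le hη0.le hη1.le hBs hBrow hBV
        (fun i j => (hBle i j).trans ((div_le_iff₀ hb).2 (hlt i j).le)) hv hmass x
    rw [max_eq_right hy] at h
    linarith
  · by_cases hij : δ * b < |M i j|
    · have hne : i ≠ j := by
        rintro rfl
        exact absurd (hdiag i) (not_le.2 hij)
      have h := abs_le_largestEigenvalue_sparse_add_rankOne (v := u) hθ.le hBs hBdiag hne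
      have hBij : |B i j| = |M i j| / b := by
        rw [hB, map_apply, largePart]
        simp [hij, abs_div, abs_of_pos hb]
      rw [hBij, div_le_iff₀ hb] at h
      refine h.trans (mul_le_mul_of_nonneg_right ?_ hb.le)
      linarith
    · refine (not_lt.1 hij).trans (mul_le_mul_of_nonneg_right ?_ hb.le)
      linarith

end Comparison

/-- With probability tending to `1`, the largest eigenvalue of the perturbed matrix is within `ρ` of
`max θ (max |a_ij| / b_n)`. -/
lemma eventually_measureReal_not_isCloseToMax_le {α : ℝ} (hα4 : α < 4)
    {μ : Measure ℝ} [IsProbabilityMeasure μ]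
    (hsymm : IsSymmetricLaw μ) (hreg : IsRegularlyVaryingLaw μ α)
    {Ω : ℕ → Type*} [∀ n, MeasurableSpace (Ω n)]
    {P : ∀ n, Measure (Ω n)} [∀ n, IsProbabilityMeasure (P n)]
    {A : ∀ n, Ω n → Matrix (Fin n) (Fin n) ℝ} (hA : ∀ n, IsWignerMatrix (A n) μ (P n))
    {θ : ℝ} (hθ : 0 < θ) {v : ∀ n, EuclideanSpace ℝ (Fin n)} (hv : ∀ n, 1 ≤ n → ‖v n‖ = 1)
    {ρ ε : ℝ} (hρ : 0 < ρ) (hε : 0 < ε) :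
    ∀ᶠ n : ℕ in atTop,
      (P n).real {ω | ¬ IsCloseToMax (normalization μ n) θ ρ (v n) (A n ω)} ≤ ε := by
  obtain ⟨c, C, hc0, hc1, hC, hmom⟩ := exists_truncatedMoment_bounds hα4 hreg
  -- The exponent `k` of the moment method is so large that `n ^ (-c k) ≤ n ^ (-c - 1)`.
  obtain ⟨k, hk3, hck⟩ : ∃ k : ℕ, 3 ≤ k ∧ 1 + c ≤ c * k := by
    obtain ⟨k, hk⟩ := exists_nat_ge ((1 + c) / c)
    refine ⟨max 3 k, le_max_left _ _, ?_⟩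
    rw [div_le_iff₀ hc0] at hk
    have : (k : ℝ) ≤ (max 3 k : ℕ) := by exact_mod_cast le_max_right 3 k
    nlinarith
  set r : ℝ := ρ / 2 with hr
  have hr0 : 0 < r := by positivity
  set K : ℝ := C ^ (2 * k) * (2 * k + 1).factorial / r ^ (2 * k) with hK
  have hC0 : 0 < C := one_pos.trans_le hC
  have hK0 : 0 < K := by positivity
  obtain ⟨δ, hδ0, hδ1, hδθ, hδK⟩ : ∃ δ, 0 < δ ∧ δ ≤ 1 ∧ δ ≤ θ ∧ K * δ ≤ ε / 4 := by
    refine ⟨min (min 1 θ) (ε / 4 / K), by positivity, (min_le_left _ _).trans (min_le_left _ _),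
      (min_le_left _ _).trans (min_le_right _ _), ?_⟩
    rw [mul_comm, ← le_div_iff₀ hK0]
    exact min_le_right _ _
  obtain ⟨η, hη0, hη1, hηr⟩ : ∃ η, 0 < η ∧ η < 1 ∧ 3 * θ * η ≤ r := by
    refine ⟨min (1 / 2) (r / (3 * θ)), by positivity, min_lt_of_left_lt (by norm_num), ?_⟩
    rw [mul_comm, ← le_div_iff₀ (by positivity)]
    exact min_le_right _ _
  have hinv : Tendsto (fun n : ℕ => ((n : ℝ))⁻¹) atTop (𝓝 0) := tendsto_inv_atTop_nhds_zero_nat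
  have hT := tendsto_sq_mul_absTail hreg hδ0
  have hlim1 : Tendsto (fun n : ℕ => (n : ℝ) * absTail μ (δ * normalization μ n)) atTop (𝓝 0) := by
    have h := hT.mul hinv
    rw [mul_zero] at h
    refine h.congr' ?_
    filter_upwards [eventually_gt_atTop 0] with n hn
    have : (n : ℝ) ≠ 0 := by positivity
    field_simp
  have hlim2 : Tendsto (fun n : ℕ => (n : ℝ) ^ 3 * absTail μ (δ * normalization μ n) ^ 2) atTop
      (𝓝 0) := by
    have h := hT.mul hlim1
    rw [mul_zero] at h
    exact h.congr fun n => by ring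
  have hlim : Tendsto (fun n : ℕ => ((n : ℝ) * absTail μ (δ * normalization μ n) +
      (n : ℝ) ^ 3 * absTail μ (δ * normalization μ n) ^ 2) +
      (n : ℝ) * absTail μ (δ * normalization μ n) / η ^ 2) atTop (𝓝 0) := by
    simpa using (hlim1.add hlim2).add (hlim1.div_const (η ^ 2))
  have hq : Tendsto (fun n : ℕ => K * (n : ℝ) ^ (-c)) atTop (𝓝 0) := by
    simpa using ((tendsto_rpow_neg_atTop hc0).comp tendsto_natCast_atTop_atTop).const_mul K
  filter_upwards [hmom, eventually_gt_atTop 0,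
    (tendsto_normalization_atTop hreg).eventually (eventually_gt_atTop 0),
    hlim.eventually (gt_mem_nhds (half_pos hε)),
    hq.eventually (gt_mem_nhds (show 0 < ε / 4 by positivity))] with n hn hn0 hb hbad hqn
  have hn1 : (1 : ℝ) ≤ n := by exact_mod_cast hn0
  have hnpos : (0 : ℝ) < n := one_pos.trans_le hn1
  have hvn : ∑ i, v n i ^ 2 = 1 := by
    have := EuclideanSpace.real_norm_sq_eq (v n)
    rw [hv n hn0, one_pow] at this
    exact this.symm
  set b := normalization μ n with hbdef
  set y := δ * b with hy
  have hsmall := measureReal_small_quadForm_le hsymm (hA n) (δ := δ) (ρ := r) (q := (n : ℝ) ^ (-c))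
    (k := k) hn0 (by omega) hb hδ0.le hδ1 hr0 hC
    (Real.rpow_le_one_of_one_le_of_nonpos hn1 (by linarith))
    (by
      rw [← Real.rpow_neg_one]
      exact Real.rpow_le_rpow_of_exponent_le hn1 (by linarith))
    (by
      rw [← Real.rpow_natCast, ← Real.rpow_mul hnpos.le, ← Real.rpow_neg_one (n : ℝ),
        ← Real.rpow_add hnpos]
      exact Real.rpow_le_rpow_of_exponent_le hn1 (by linarith)) hn.1 hn.2
  have hsmall' : (P n).real {ω | ¬ ∀ x : Fin n → ℝ,
      |x ⬝ᵥ ((A n ω).map (smallPart b δ)).mulVec x| ≤ r * (x ⬝ᵥ x)} ≤ ε / 2 := by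
    refine hsmall.trans ?_
    have hδk : δ ^ (2 * k - 4) ≤ δ := by
      obtain ⟨j, hj⟩ : ∃ j, 2 * k - 4 = j + 1 := ⟨2 * k - 5, by omega⟩
      rw [hj, pow_succ]
      exact mul_le_of_le_one_left hδ0.le (pow_le_one₀ hδ0.le hδ1)
    calc C ^ (2 * k) * ((n : ℝ) ^ (-c) + δ ^ (2 * k - 4)) * (2 * k + 1).factorial / r ^ (2 * k)
        = K * (n : ℝ) ^ (-c) + K * δ ^ (2 * k - 4) := by rw [hK]; ring
      _ ≤ ε / 4 + K * δ := by gcongr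
      _ ≤ ε / 2 := by linarith
  have hmatch := measureReal_not_matching_le (hA n) y
  have hmass := measureReal_mass_le (hA n) y (v := fun i => v n i) hvn
    (show 0 < η ^ 2 by positivity)
  have hsub : {ω | ¬ IsCloseToMax b θ ρ (v n) (A n ω)} ⊆
      ({ω | (∃ i, y < |A n ω i i|) ∨ ∃ i j k, j ≠ k ∧ y < |A n ω i j| ∧ y < |A n ω i k|} ∪
        {ω | η ^ 2 ≤ ∑ i with ∃ j, y < |A n ω i j|, v n i ^ 2}) ∪
      {ω | ¬ ∀ x : Fin n → ℝ, |x ⬝ᵥ ((A n ω).map (smallPart b δ)).mulVec x| ≤ r * (x ⬝ᵥ x)} := by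
    intro ω hω
    by_contra hcon
    simp only [Set.mem_union, Set.mem_ofPred_eq, not_or, not_le, not_not] at hcon
    obtain ⟨⟨h1, h2⟩, h3⟩ := hcon
    have h := isCloseToMax_of_matching ((hA n).symm ω) hn0 hb hθ hδθ hη0 hη1 hηr hvn
      (not_or.2 h1) h2.le h3
    rw [show 2 * r = ρ by rw [hr]; ring] at h
    exact hω h
  calc (P n).real {ω | ¬ IsCloseToMax b θ ρ (v n) (A n ω)} ≤ _ := measureReal_mono hsub
    _ ≤ _ := (measureReal_union_le _ _).trans (add_le_add_left (measureReal_union_le _ _) _)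
    _ ≤ ((n * absTail μ y + n ^ 3 * absTail μ y ^ 2) + n * absTail μ y / η ^ 2) + ε / 2 := by
      gcongr
    _ ≤ ε := by linarith

/-! ### The largest entry -/

/-- The exponent `(n + 1).choose 2` is the number of independent entries, one for each unordered
pair of indices. -/
lemma tendsto_one_sub_pow_choose {t : ℕ → ℝ} {c : ℝ}
    (ht : Tendsto (fun n : ℕ => (n : ℝ) ^ 2 * t n) atTop (𝓝 (2 * c))) :
    Tendsto (fun n : ℕ => (1 - t n) ^ ((n + 1).choose 2)) atTop (𝓝 (Real.exp (-c))) := by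
  have hinv : Tendsto (fun n : ℕ => ((n : ℝ))⁻¹) atTop (𝓝 0) := tendsto_inv_atTop_nhds_zero_nat
  have ht0 : Tendsto t atTop (𝓝 0) := by
    have h := ht.mul (hinv.mul hinv)
    rw [mul_zero, mul_zero] at h
    refine h.congr' ?_
    filter_upwards [eventually_gt_atTop 0] with n hn
    have : (n : ℝ) ≠ 0 := by positivity
    field_simp
  have hN : Tendsto (fun n : ℕ => ((n + 1).choose 2 : ℝ) * t n) atTop (𝓝 c) := by
    have h := (ht.mul (hinv.const_add 1)).div_const 2
    rw [add_zero, mul_one, mul_div_cancel_left₀ _ two_ne_zero] at h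
    refine h.congr' ?_
    filter_upwards [eventually_gt_atTop 0] with n hn
    have : (n : ℝ) ≠ 0 := by positivity
    rw [Nat.cast_choose_two]
    push_cast
    field_simp
    ring
  have hlog : Tendsto (fun n : ℕ => ((n + 1).choose 2 : ℝ) * Real.log (1 - t n)) atTop
      (𝓝 (-c)) := by
    have h1t : Tendsto (fun n => 1 - t n) atTop (𝓝 1) := by simpa using ht0.const_sub 1
    have hlow : Tendsto (fun n : ℕ => -(((n + 1).choose 2 : ℝ) * t n) / (1 - t n)) atTop
        (𝓝 (-c)) := by
      rw [← div_one (-c)]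
      exact hN.neg.div h1t one_ne_zero
    refine tendsto_of_tendsto_of_tendsto_of_le_of_le' hlow hN.neg ?_ ?_
    · filter_upwards [h1t.eventually (lt_mem_nhds one_pos)] with n hn
      have h := Real.one_sub_inv_le_log_of_pos hn
      calc -(((n + 1).choose 2 : ℝ) * t n) / (1 - t n)
          = ((n + 1).choose 2 : ℝ) * (1 - (1 - t n)⁻¹) := by field_simp; ring
        _ ≤ _ := by gcongr
    · filter_upwards [h1t.eventually (lt_mem_nhds one_pos)] with n hn
      have h := Real.log_le_sub_one_of_pos hn
      calc ((n + 1).choose 2 : ℝ) * Real.log (1 - t n)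
          ≤ ((n + 1).choose 2 : ℝ) * (1 - t n - 1) := by gcongr
        _ = _ := by ring
  refine ((Real.continuous_exp.tendsto _).comp hlog).congr' ?_
  filter_upwards [ht0.eventually (gt_mem_nhds one_pos)] with n hn
  rw [Function.comp, mul_comm, ← Real.rpow_def_of_pos (by linarith), Real.rpow_natCast]

/-- The largest entry of the normalized matrix has asymptotically a Fréchet law. -/
lemma tendsto_measureReal_forall_abs_lt {α : ℝ}
    {μ : Measure ℝ} [IsProbabilityMeasure μ] (hreg : IsRegularlyVaryingLaw μ α)
    {Ω : ℕ → Type*} [∀ n, MeasurableSpace (Ω n)]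
    {P : ∀ n, Measure (Ω n)} [∀ n, IsProbabilityMeasure (P n)]
    {A : ∀ n, Ω n → Matrix (Fin n) (Fin n) ℝ} (hA : ∀ n, IsWignerMatrix (A n) μ (P n))
    {y : ℝ} (hy : 0 < y) :
    Tendsto (fun n : ℕ => (P n).real {ω | ∀ i j, |A n ω i j| < y * normalization μ n}) atTop
      (𝓝 (Real.exp (-y ^ (-α)))) := by
  refine (tendsto_one_sub_pow_choose (tendsto_sq_mul_absTail hreg hy)).congr fun n => ?_
  set x := y * normalization μ n
  have hms : MeasurableSet {t : ℝ | |t| < x} :=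
    measurableSet_lt continuous_abs.measurable measurable_const
  have hset : {ω | ∀ i j, |A n ω i j| < x} =
      ⋂ z, pairEntry (A n) z ⁻¹' {t : ℝ | |t| < x} := by
    ext ω
    simp only [(hA n).apply_eq, Set.mem_ofPred_eq, Set.mem_iInter, Set.mem_preimage]
    exact ⟨fun h z => Sym2.ind (fun i j => h i j) z, fun h i j => h s(i, j)⟩
  have hcompl : {t : ℝ | |t| < x} = {t : ℝ | x ≤ |t|}ᶜ := by
    ext t
    simp
  have hone : ∀ z, (P n).real (pairEntry (A n) z ⁻¹' {t : ℝ | |t| < x}) = 1 - absTail μ x := by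
    intro z
    have := ((hA n).hasLaw_pairEntry z).measureReal_eq (p := fun t => |t| < x) hms
    rw [absTail, ← probReal_compl_eq_one_sub (measurableSet_le_abs x), ← hcompl]
    exact this
  rw [hset, Measure.real, (hA n).iIndepFun_pairEntry.meas_iInter fun z => ⟨_, hms, rfl⟩,
    ENNReal.toReal_prod]
  have : ∀ z, ((P n) (pairEntry (A n) z ⁻¹' {t : ℝ | |t| < x})).toReal = 1 - absTail μ x := hone
  simp only [this, Finset.prod_const, Finset.card_univ, Sym2.card, Fintype.card_fin]

/-! ### Convergence of the distribution functions -/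

lemma IsFrechet.measureReal_le {α : ℝ} {Ω' : Type*} [MeasurableSpace Ω'] {P' : Measure Ω'}
    [IsProbabilityMeasure P'] {E : Ω' → ℝ} (hE : IsFrechet E α P') {x : ℝ} (hx : 0 < x) :
    P'.real {ω | E ω ≤ x} = Real.exp (-x ^ (-α)) := by
  have hcont : ContinuousAt (fun x : ℝ => Real.exp (-x ^ (-α))) x :=
    (Real.continuousAt_rpow_const _ _ (Or.inl hx.ne')).neg.rexp
  refine le_antisymm ?_ ?_
  · refine ge_of_tendsto (hcont.tendsto.mono_left (nhdsWithin_le_nhds (s := Set.Ioi x))) ?_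
    filter_upwards [self_mem_nhdsWithin] with y hy
    rw [← hE.prob_lt y (hx.trans hy)]
    exact measureReal_mono fun ω (hω : E ω ≤ x) => show E ω < y from hω.trans_lt hy
  · rw [← hE.prob_lt x hx]
    exact measureReal_mono fun ω (hω : E ω < x) => show E ω ≤ x from hω.le

lemma IsFrechet.measureReal_max_le {α : ℝ} {Ω' : Type*} [MeasurableSpace Ω'] {P' : Measure Ω'}
    [IsProbabilityMeasure P'] {E : Ω' → ℝ} (hE : IsFrechet E α P') {θ : ℝ} (hθ : 0 < θ) (x : ℝ) :
    P'.real {ω | max θ (E ω) ≤ x} = if θ ≤ x then Real.exp (-x ^ (-α)) else 0 := by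
  split_ifs with h
  · rw [← hE.measureReal_le (hθ.trans_le h)]
    simp [h]
  · simp [h]

/-- A sequence of real random variables converges in distribution if its distribution functions
converge off a single point. -/
lemma tendstoInDistribution_of_tendsto_cdf {Ω : ℕ → Type*} [∀ n, MeasurableSpace (Ω n)]
    {P : ∀ n, Measure (Ω n)} [∀ n, IsProbabilityMeasure (P n)] {Ω' : Type*} [MeasurableSpace Ω']
    {P' : Measure Ω'} [IsProbabilityMeasure P'] {X : ∀ n, Ω n → ℝ} {Z : Ω' → ℝ}
    (hX : ∀ n, AEMeasurable (X n) (P n)) (hZ : AEMeasurable Z P') (θ : ℝ)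
    (h : ∀ x, x ≠ θ → Tendsto (fun n => (P n).real {ω | X n ω ≤ x}) atTop
      (𝓝 (P'.real {ω | Z ω ≤ x}))) :
    TendstoInDistribution X atTop Z P P' := by
  refine ⟨hX, hZ, ?_⟩
  have hIoc : ∀ (ν : Measure ℝ) [IsProbabilityMeasure ν] (a b : ℝ), a ≤ b →
      ν.real (Set.Ioc a b) = ν.real (Set.Iic b) - ν.real (Set.Iic a) := by
    intro ν _ a b hab
    rw [← Set.Iic_sdiff_Iic, measureReal_sdiff (Set.Iic_subset_Iic.2 hab) measurableSet_Iic]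
  refine IsPiSystem.tendsto_probabilityMeasure_of_tendsto_of_mem
    (isPiSystem_Ioc_mem {x : ℝ | x ≠ θ} {x : ℝ | x ≠ θ}) ?_ ?_ ?_
  · rintro _ ⟨a, -, b, -, -, rfl⟩
    exact measurableSet_Ioc
  · intro u hu x hx
    obtain ⟨r, hr, hru⟩ := Metric.isOpen_iff.1 hu x hx
    have hinf : ∀ p q : ℝ, p < q → ∃ a, p < a ∧ a < q ∧ a ≠ θ := by
      intro p q hpq
      by_cases hm : (p + q) / 2 = θ
      · exact ⟨(2 * p + q) / 3, by linarith, by linarith, fun h => by linarith⟩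
      · exact ⟨(p + q) / 2, by linarith, by linarith, hm⟩
    obtain ⟨a, ha1, ha2, haθ⟩ := hinf (x - r) x (by linarith)
    obtain ⟨b, hb1, hb2, hbθ⟩ := hinf x (x + r) (by linarith)
    refine ⟨Set.Ioc a b, ⟨a, haθ, b, hbθ, ha2.trans hb1, rfl⟩, Ioc_mem_nhds ha2 hb1,
      fun t ht => hru ?_⟩
    rw [Metric.mem_ball, Real.dist_eq, abs_lt]
    constructor <;> linarith [ht.1, ht.2]
  · rintro _ ⟨a, ha, b, hb, hab, rfl⟩
    rw [← NNReal.tendsto_coe]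
    have hmap : ∀ n x, ((P n).map (X n)).real (Set.Iic x) = (P n).real {ω | X n ω ≤ x} :=
      fun n x => map_measureReal_apply_of_aemeasurable (hX n) measurableSet_Iic
    have hmap' : ∀ x, (P'.map Z).real (Set.Iic x) = P'.real {ω | Z ω ≤ x} :=
      fun x => map_measureReal_apply_of_aemeasurable hZ measurableSet_Iic
    have hPX : ∀ n, IsProbabilityMeasure ((P n).map (X n)) := fun n =>
      Measure.isProbabilityMeasure_map (hX n)
    have hPZ : IsProbabilityMeasure (P'.map Z) := Measure.isProbabilityMeasure_map hZ
    have hlim := (h b hb).sub (h a ha)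
    simp only [← hmap, ← hmap', ← hIoc _ a b hab.le] at hlim
    exact hlim

theorem theorem1
    (α : ℝ) (hα0 : 0 < α) (hα4 : α < 4)
    (μ : Measure ℝ) [IsProbabilityMeasure μ]
    (hsymm : IsSymmetricLaw μ) (hreg : IsRegularlyVaryingLaw μ α)
    (Ω : ℕ → Type*) [∀ n, MeasurableSpace (Ω n)]
    (P : ∀ n, Measure (Ω n)) [∀ n, IsProbabilityMeasure (P n)]
    (A : ∀ n, Ω n → Matrix (Fin n) (Fin n) ℝ)
    (hA : ∀ n, IsWignerMatrix (A n) μ (P n))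
    (θ : ℝ) (hθ : 0 < θ)
    (v : ∀ n, EuclideanSpace ℝ (Fin n)) (hv : ∀ n, 1 ≤ n → ‖v n‖ = 1)
    (Ω' : Type*) [MeasurableSpace Ω'] (P' : Measure Ω') [IsProbabilityMeasure P']
    (E : Ω' → ℝ) (hE : IsFrechet E α P') :
    TendstoInDistribution
      (fun (n : ℕ) ω => largestEigenvalue (perturbedMatrix (normalization μ n) θ (v n) (A n ω)))
      atTop (fun ω' => max θ (E ω')) P P' := by
  refine tendstoInDistribution_of_tendsto_cdf
    (fun n => aemeasurable_largestEigenvalue (hA n) _ _ _)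
    (aemeasurable_const.max hE.aemeasurable) θ fun x hx => ?_
  rw [hE.measureReal_max_le hθ]
  rcases lt_or_gt_of_ne hx with hlt | hgt
  · rw [if_neg (not_le.2 hlt), tendsto_order]
    refine ⟨fun r hr => Eventually.of_forall fun n => hr.trans_le measureReal_nonneg,
      fun r hr => ?_⟩
    filter_upwards [eventually_measureReal_not_isCloseToMax_le hα4 hsymm hreg hA hθ hv
      (half_pos (sub_pos.2 hlt)) (half_pos hr)] with n hn
    refine lt_of_le_of_lt (le_trans (measureReal_mono fun ω hω => ?_) hn) (half_lt_self hr)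
    intro hclose
    have h1 := hclose.theta_le
    have h2 : largestEigenvalue _ ≤ x := hω
    linarith
  · rw [if_pos hgt.le]
    have hx0 : 0 < x := hθ.trans hgt
    have hcont : Tendsto (fun x : ℝ => Real.exp (-x ^ (-α))) (𝓝 x) (𝓝 (Real.exp (-x ^ (-α)))) :=
      ContinuousAt.tendsto (Real.continuousAt_rpow_const _ _ (Or.inl hx0.ne')).neg.rexp
    rw [tendsto_order]
    constructor
    · intro r hr
      -- `λ ≤ x` as soon as all normalized entries are below some `y < x` close to `x`.
      have h1 : ∀ᶠ y in 𝓝[<] x, r < Real.exp (-y ^ (-α)) ∧ θ < y :=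
        nhdsWithin_le_nhds ((hcont.eventually (lt_mem_nhds hr)).and (lt_mem_nhds hgt))
      obtain ⟨y, ⟨hry, hθy⟩, hyx⟩ := (h1.and self_mem_nhdsWithin).exists
      have hyx : y < x := hyx
      obtain ⟨r', hr1, hr2⟩ := exists_between hry
      filter_upwards [eventually_measureReal_not_isCloseToMax_le hα4 hsymm hreg hA hθ hv
        (sub_pos.2 hyx) (sub_pos.2 hr1),
        (tendsto_measureReal_forall_abs_lt hreg hA (hθ.trans hθy)).eventually
          (lt_mem_nhds hr2)] with n hn1 hn2
      have hsub : {ω | ∀ i j, |A n ω i j| < y * normalization μ n} ⊆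
          {ω | largestEigenvalue (perturbedMatrix (normalization μ n) θ (v n) (A n ω)) ≤ x} ∪
          {ω | ¬ IsCloseToMax (normalization μ n) θ (x - y) (v n) (A n ω)} := by
        intro ω hω
        by_cases hclose : IsCloseToMax (normalization μ n) θ (x - y) (v n) (A n ω)
        · have := hclose.le_of_entries_lt y hθy.le hω
          exact Or.inl (show largestEigenvalue _ ≤ x by linarith)
        · exact Or.inr hclose
      have := (measureReal_mono (μ := P n) hsub).trans (measureReal_union_le _ _)
      linarith
    · intro r hr
      -- `λ ≤ x` forces all normalized entries to be below any given `y > x`.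
      have h1 : ∀ᶠ y in 𝓝[>] x, Real.exp (-y ^ (-α)) < r :=
        nhdsWithin_le_nhds (hcont.eventually (gt_mem_nhds hr))
      obtain ⟨y, hry, hxy⟩ := (h1.and self_mem_nhdsWithin).exists
      have hxy : x < y := hxy
      obtain ⟨r', hr1, hr2⟩ := exists_between hry
      filter_upwards [eventually_measureReal_not_isCloseToMax_le hα4 hsymm hreg hA hθ hv
        (half_pos (sub_pos.2 hxy)) (sub_pos.2 hr2),
        (tendsto_measureReal_forall_abs_lt hreg hA (hx0.trans hxy)).eventually (gt_mem_nhds hr1),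
        (tendsto_normalization_atTop hreg).eventually (eventually_gt_atTop 0)] with n hn1 hn2 hb
      have hsub :
          {ω | largestEigenvalue (perturbedMatrix (normalization μ n) θ (v n) (A n ω)) ≤ x} ⊆
          {ω | ∀ i j, |A n ω i j| < y * normalization μ n} ∪
          {ω | ¬ IsCloseToMax (normalization μ n) θ ((y - x) / 2) (v n) (A n ω)} := by
        intro ω hω
        by_cases hclose : IsCloseToMax (normalization μ n) θ ((y - x) / 2) (v n) (A n ω)
        · refine Or.inl fun i j => (hclose.entries_le x hgt.le hω i j).trans_lt ?_
          exact mul_lt_mul_of_pos_right (by linarith) hb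
        · exact Or.inr hclose
      have := (measureReal_mono (μ := P n) hsub).trans (measureReal_union_le _ _)
      linarith
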